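/- Conventions. A qustring of length $n$ is a unit vector of $(\mathbb{C}^2)^{\otimes n}$. For $\phi=\sum_x\alpha_x|x_1\cdots x_n\rangle$ and a permutation $\sigma$ of $\{1,\dots,n\}$ put $\sigma(\phi)=\sum_x\alpha_x|x_{\sigma(1)}\cdots x_{\sigma(n)}\rangle$. A qustring $\phi$ is $k$-separable if $\sigma(\phi)=\phi_1\otimes\cdots\otimes\phi_k$ for some permutation $\sigma$ and some qustrings $\phi_i$ of lengths $m_i\ge 1$; we then say that $\sigma$ achieves the $k$-separability of $\phi$ with sectioning $\vec m=(m_1,\dots,m_k)$. The separability index of $\phi$ is the largest $k\le n$ for which $\phi$ is $k$-separable, and $\phi$ is partially entangled if its index is at most $n-1$. An entanglement ensemble with size factor $\ell$, where $\ell:\mathbb{N}\to\mathbb{N}$ is strictly increasing, is a sequence $\Xi=(\xi_n)_{n\in\mathbb{N}}$ of qustrings, $\xi_n$ of length $\ell(n)$, such that $\xi_n$ is partially entangled whenever $\ell(n)\ge 2$. With $\|X\|_{\mathrm{tr}}=\frac12\mathrm{Tr}\sqrt{X^\dagger X}$, let $sdis_k(\xi)$ be the infimum of $\||\xi\rangle\langle\xi|-|\phi\rangle\langle\phi|\|_{\mathrm{tr}}$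 over all $k$-separable $\phi$ of the same length as $\xi$ ($+\infty$ if there are none). $\Xi$ is $(k,\delta)$-far from separable states if $sdis_{k(n)}(\xi_n)>\delta(n)$ for all but finitely many $n$. Quantum circuits are built over a fixed finite set $\mathcal G$ of unitary gates that contains the identity, NOT, Hadamard, $T=\mathrm{diag}(1,e^{i\pi/4})$ and controlled-NOT (so $\mathcal G$ is universal); they may use ancilla qubits, initially $|0\rangle$; the size is the number of gates; one qubit is measured at the end as the output bit. Write $1^{\sigma}=1^{\sigma(1)}0\cdots1^{\sigma(n)}0$, $1^{\vec m}=1^{m_1}0\cdots1^{m_k}0$ and $1^{\sigma,\vec m}=1^{\sigma}01^{\vec m}0$. $\Xi$ is $(k,\eta,s)$-distinguishable from separable states if there is a (non-uniform) family $(D_n)$ of quantum circuits, $D_n$ of size at most $s(n)$ with $\ell(n)^2/2+7\ell(n)/2+k(n)+2$ input qubits, such that for all but finitely many $n$ one has $$\bigl|\Pr[D_n(|1^{\sigma,\vec m}\rangle|\xi_n\rangle)=1]-\Pr[D_n(|1^{\sigma,\vec m}\rangle|\phi\rangle)=1]\bigr|\ge\eta(n)$$ for every $k(n)$-separable qustring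 $\phi$ of length $\ell(n)$ and every permutation $\sigma$ that achieves the $k(n)$-separability of $\phi$ with sectioning $\vec m$. Corollary. Let $k:\mathbb{N}\to\mathbb{N}\setminus\{0,1\}$, $\ell:\mathbb{N}\to\mathbb{N}$, $\epsilon:\mathbb{N}\to(0,1]$ and $\delta:\mathbb{N}\to[0,1]$ with $\delta(n)>\epsilon(n)+\sqrt{\epsilon(n)}$ for all $n$, and suppose that $$\ell(n)^2\,2^{\ell(n)}\log_2^2\frac{\ell(n)^2\,2^{2\ell(n)}}{\epsilon(n)}\in O\bigl(2^{2\ell(n)}\bigr)$$ (which holds, for instance, for every constant $\epsilon$). Then every entanglement ensemble with size factor $\ell$ that is $(k,\delta)$-far from separable states is $(k,\epsilon',s)$-distinguishable from separable states for some $s$ with $s(n)\in O(2^{2\ell(n)})$, where $\epsilon'(n)=\frac{(\delta(n)-\epsilon(n))^2-\epsilon(n)}{2}$. For size factor $\ell(n)=n$ the bound is $O(2^{2n})$. -/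

import Mathlib

open Filter Asymptotics

noncomputable section

namespace QEnt

/-! ## Quantum strings and separability -/

/-- The Hilbert space of `n` qubits, with standard basis indexed by the bit strings of length `n`
(`true` is the bit 1). -/
abbrev Qubits (n : ℕ) : Type := EuclideanSpace ℂ (Fin n → Bool)

/-- A qustring of length `n`: a unit vector of the Hilbert space of `n` qubits. -/
abbrev Qustring (n : ℕ) : Type := {v : Qubits n // ‖v‖ = 1}

/-- The vector `σ(φ) = ∑ₓ αₓ |x_{σ(1)} ⋯ x_{σ(n)}⟩`, for `φ = ∑ₓ αₓ |x₁ ⋯ xₙ⟩`. Its amplitude at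
`y = x ∘ σ` is `αₓ`. -/
def permute {n : ℕ} (σ : Equiv.Perm (Fin n)) (φ : Qubits n) : Qubits n :=
  WithLp.toLp 2 fun y => φ (y ∘ σ.symm)

/-- The tensor product `ψ₁ ⊗ ⋯ ⊗ ψₖ` where the lengths of the factors form the composition
`m = (m₁, …, mₖ)` of `n` (all parts of a `Composition` are positive). The `i`-th factor reads the
`i`-th block of consecutive bits. -/
def tensor {n : ℕ} (m : Composition n) (ψ : ∀ i : Fin m.length, Qubits (m.blocksFun i)) :
    Qubits n :=
  WithLp.toLp 2 fun y => ∏ i, ψ i (y ∘ m.embedding i)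

/-- `σ` achieves the separability of `φ` with sectioning `m = (m₁, …, mₖ)`: `φ` is isotopic via `σ`
to a tensor product of qustrings of the lengths `m₁, …, mₖ`. -/
def Achieves {n : ℕ} (σ : Equiv.Perm (Fin n)) (m : Composition n) (φ : Qustring n) : Prop :=
  ∃ ψ : ∀ i : Fin m.length, Qustring (m.blocksFun i),
    permute σ φ.1 = tensor m fun i => (ψ i).1

/-- `φ` is `k`-separable. -/
def IsSeparable {n : ℕ} (k : ℕ) (φ : Qustring n) : Prop :=
  ∃ (σ : Equiv.Perm (Fin n)) (m : Composition n), m.length = k ∧ Achieves σ m φ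

/-- The separability index: the largest `k` with `1 ≤ k ≤ n` such that `φ` is `k`-separable. -/
def sind {n : ℕ} (φ : Qustring n) : ℕ :=
  sSup {k | 1 ≤ k ∧ k ≤ n ∧ IsSeparable k φ}

/-- Partially entangled: separability index at most `n - 1`. -/
def PartiallyEntangled {n : ℕ} (φ : Qustring n) : Prop := sind φ < n

/-- `Ξ = (ξ n)` is an entanglement ensemble with size factor `ℓ`. No qustring of length less than 2
is partially entangled, so the condition is imposed on the members of length at least 2; this
admits the size factor `ℓ n = n`. -/
def IsEntanglementEnsemble (ℓ : ℕ → ℕ) (ξ : ∀ n, Qustring (ℓ n)) : Prop :=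
  StrictMono ℓ ∧ ∀ n, 2 ≤ ℓ n → PartiallyEntangled (ξ n)

/-! ## Trace norm and separability distance -/

/-- The trace norm `½ Tr √(Xᴴ X)`; the trace of the square root is the sum of the square roots of
the eigenvalues of `Xᴴ X`. -/
def trNorm {ι : Type} [Fintype ι] [DecidableEq ι] (X : Matrix ι ι ℂ) : ℝ :=
  (1 / 2) * ∑ i, √((Matrix.isHermitian_conjTranspose_mul_self X).eigenvalues i)

/-- The density operator `|φ⟩⟨φ|`. -/
def ketbra {n : ℕ} (φ : Qubits n) : Matrix (Fin n → Bool) (Fin n → Bool) ℂ :=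
  Matrix.vecMulVec φ.ofLp (star φ.ofLp)

/-- The `k`-separability distance: the infimum of the trace distances from `ξ` to the `k`-separable
qustrings of the same length (`∞` if there are none, that is, if `k` exceeds the length). -/
def sdis {n : ℕ} (k : ℕ) (ξ : Qustring n) : ENNReal :=
  ⨅ (φ : Qustring n) (_ : IsSeparable k φ), ENNReal.ofReal (trNorm (ketbra ξ.1 - ketbra φ.1))

/-- The ensemble `ξ` is `(k, δ)`-far from separable states. -/
def FarFromSeparable {ℓ : ℕ → ℕ} (k : ℕ → ℕ) (δ : ℕ → ℝ) (ξ : ∀ n, Qustring (ℓ n)) : Prop :=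
  ∀ᶠ n in atTop, ENNReal.ofReal (δ n) < sdis (k n) (ξ n)

/-! ## Quantum circuits -/

/-- A quantum gate on `arity` qubits. -/
structure Gate where
  arity : ℕ
  mat : Matrix (Fin arity → Bool) (Fin arity → Bool) ℂ
  unitary : mat ∈ Matrix.unitaryGroup (Fin arity → Bool) ℂ

/-- The one-qubit gate with a given matrix in the basis `|0⟩, |1⟩`. -/
def Gate.single (U : Matrix Bool Bool ℂ) (hU : U ∈ Matrix.unitaryGroup Bool ℂ) : Gate where
  arity := 1
  mat := U.submatrix (fun x => x 0) (fun x => x 0)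
  unitary := by
    rw [Matrix.mem_unitaryGroup_iff, Matrix.star_eq_conjTranspose] at hU ⊢
    have e : (fun x : Fin 1 → Bool => x 0) = Equiv.funUnique (Fin 1) Bool := by
      ext x; simp [Equiv.funUnique]
    rw [Matrix.conjTranspose_submatrix, e, Matrix.submatrix_mul_equiv, hU,
      Matrix.submatrix_one_equiv]

/-- The identity gate. -/
def idGate : Gate := Gate.single 1 (one_mem _)

/-- The NOT gate. -/
def notGate : Gate :=
  Gate.single (Matrix.of fun a b => if a = !b then 1 else 0) (by
    rw [Matrix.mem_unitaryGroup_iff]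
    ext a b
    cases a <;> cases b <;> simp [Matrix.mul_apply, Matrix.star_apply])

/-- The Hadamard gate. -/
def hadamardGate : Gate :=
  Gate.single (Matrix.of fun a b => (if a && b then -1 else 1) / ((√2 : ℝ) : ℂ)) (by
    have h : ((√2 : ℝ) : ℂ) * ((√2 : ℝ) : ℂ) = 2 := by
      rw [← Complex.ofReal_mul, Real.mul_self_sqrt (by norm_num)]; norm_num
    have h0 : ((√2 : ℝ) : ℂ) ≠ 0 := by
      intro h'; rw [h'] at h; norm_num at h
    rw [Matrix.mem_unitaryGroup_iff]
    ext a b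
    cases a <;> cases b <;> simp [Matrix.mul_apply, Matrix.star_apply] <;> field_simp <;>
      rw [pow_two, h] <;> norm_num)

/-- The gate `T = diag(1, e^{iπ/4})`. -/
def tGate : Gate :=
  Gate.single (Matrix.diagonal fun a => if a then Complex.exp ((Real.pi / 4 : ℝ) * Complex.I) else 1) (by
    rw [Matrix.mem_unitaryGroup_iff, Matrix.star_eq_conjTranspose, Matrix.diagonal_conjTranspose,
      Matrix.diagonal_mul_diagonal, ← Matrix.diagonal_one]
    congr 1
    ext a
    cases a
    · simp
    · simp only [if_true, Pi.star_apply, RCLike.star_def, ← Complex.exp_conj, map_mul,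
        Complex.conj_ofReal, Complex.conj_I, ← Complex.exp_add]
      simp)

/-- The controlled-NOT gate `|a, b⟩ ↦ |a, a ⊕ b⟩`. -/
def cnotGate : Gate where
  arity := 2
  mat := Matrix.of fun x y => if x = ![y 0, xor (y 0) (y 1)] then 1 else 0
  unitary := by
    have key : ∀ x y : Fin 2 → Bool,
        x = ![y 0, xor (y 0) (y 1)] ↔ y = ![x 0, xor (x 0) (x 1)] := by decide
    have key2 : ∀ x y : Fin 2 → Bool,
        x = ![(![y 0, xor (y 0) (y 1)] : Fin 2 → Bool) 0,
          xor ((![y 0, xor (y 0) (y 1)] : Fin 2 → Bool) 0)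
            ((![y 0, xor (y 0) (y 1)] : Fin 2 → Bool) 1)] ↔ x = y := by decide
    rw [Matrix.mem_unitaryGroup_iff]
    ext x z
    simp only [Matrix.mul_apply, Matrix.star_apply, Matrix.of_apply, key z, apply_ite star,
      star_one, star_zero, mul_ite, mul_one, mul_zero, Finset.sum_ite_eq', Finset.mem_univ,
      if_true, Matrix.one_apply, key2]

/-- A finite set of quantum gates that contains the identity, NOT and the standard generators of
quantum computation: Hadamard, `T` and controlled-NOT. Every such set is universal. -/
structure IsStandardGateSet (𝒢 : Set Gate) : Prop where
  finite : 𝒢.Finite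
  id_mem : idGate ∈ 𝒢
  not_mem : notGate ∈ 𝒢
  hadamard_mem : hadamardGate ∈ 𝒢
  t_mem : tGate ∈ 𝒢
  cnot_mem : cnotGate ∈ 𝒢

/-- The action of a gate on an `M`-qubit register; the `j`-th qubit of the gate is put on the
wire `e j`. `Function.extend e y x` is the string `x` with the bits on these wires overwritten
by `y`. -/
def Gate.apply (g : Gate) {M : ℕ} (e : Fin g.arity ↪ Fin M) (v : Qubits M) : Qubits M :=
  WithLp.toLp 2 fun x => ∑ y : Fin g.arity → Bool, g.mat (x ∘ e) y * v (Function.extend e y x)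

/-- A quantum circuit over the gate set `𝒢` with `N` input qubits: a number of ancilla qubits
(the last wires), a sequence of gates placed on wires (the head of the list acts first), and the
wire that is measured at the end. -/
structure Circuit (𝒢 : Set Gate) (N : ℕ) where
  ancillas : ℕ
  ops : List (Σ g : Gate, Fin g.arity ↪ Fin (N + ancillas))
  ops_mem : ∀ o ∈ ops, o.1 ∈ 𝒢
  output : Fin (N + ancillas)

namespace Circuit

variable {𝒢 : Set Gate} {N : ℕ}

/-- The size of a circuit: its number of gates. -/
def size (C : Circuit 𝒢 N) : ℕ := C.ops.length

/-- The initial state `|φ⟩|0 ⋯ 0⟩`. -/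
def init (C : Circuit 𝒢 N) (φ : Qubits N) : Qubits (N + C.ancillas) :=
  WithLp.toLp 2 fun x =>
    if x ∘ Fin.natAdd N = fun _ => false then φ (x ∘ Fin.castAdd C.ancillas) else 0

/-- The state at the end of the computation on input `|φ⟩`. -/
def run (C : Circuit 𝒢 N) (φ : Qubits N) : Qubits (N + C.ancillas) :=
  C.ops.foldl (fun v o => o.1.apply o.2 v) (C.init φ)

/-- The probability that the measured output bit is 1 on input `|φ⟩`. -/
def acceptProb (C : Circuit 𝒢 N) (φ : Qubits N) : ℝ :=
  ∑ x : Fin (N + C.ancillas) → Bool, if x C.output then ‖C.run φ x‖ ^ 2 else 0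

/-- The circuit `ε`-distinguishes between `φ` and `ψ`. -/
def Distinguishes (C : Circuit 𝒢 N) (ε : ℝ) (φ ψ : Qubits N) : Prop :=
  ε ≤ |C.acceptProb φ - C.acceptProb ψ|

end Circuit

/-! ## Distinguishers -/

/-- The string `1^{a₁} 0 1^{a₂} 0 ⋯ 1^{aᵣ} 0`. -/
def unary (l : List ℕ) : List Bool := l.flatMap fun a => List.replicate a true ++ [false]

/-- The string `1^{σ,m} = 1^σ 0 1^m 0`, where `1^σ = 1^{σ(1)} 0 ⋯ 1^{σ(n)} 0` (with `σ` viewed as a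
permutation of `{1, …, n}`) and `1^m = 1^{m₁} 0 ⋯ 1^{mₖ} 0`. -/
def labelList {n : ℕ} (σ : Equiv.Perm (Fin n)) (m : Composition n) : List Bool :=
  unary (List.ofFn fun i => (σ i : ℕ) + 1) ++ [false] ++ unary m.blocks ++ [false]

/-- The length `n²/2 + 5n/2 + k + 2` of the string `1^{σ,m}`. -/
def labelLength (n k : ℕ) : ℕ := n * (n + 5) / 2 + k + 2

theorem length_unary (l : List ℕ) : (unary l).length = l.sum + l.length := by
  induction l with
  | nil => rfl
  | cons a l ih =>
    have : unary (a :: l) = (List.replicate a true ++ [false]) ++ unary l := by simp [unary]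
    rw [this, List.length_append, ih]
    simp
    omega

theorem length_labelList {n : ℕ} (σ : Equiv.Perm (Fin n)) (m : Composition n) :
    (labelList σ m).length = labelLength n m.length := by
  have h1 : (List.ofFn fun i => (σ i : ℕ) + 1).sum = n * (n + 1) / 2 := by
    rw [List.sum_ofFn, Equiv.sum_comp σ (fun i : Fin n => (i : ℕ) + 1),
      Fin.sum_univ_eq_sum_range (fun i => i + 1) n]
    have := Finset.sum_range_succ' (fun i => i) n
    simp only [add_zero] at this
    rw [← this, Finset.sum_range_id, Nat.add_sub_cancel, mul_comm]
  have h2 : n * (n + 5) / 2 = n * (n + 1) / 2 + 2 * n := by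
    have : n * (n + 5) = n * (n + 1) + (2 * n) * 2 := by ring
    rw [this, Nat.add_mul_div_right _ _ (by norm_num)]
  simp only [labelList, labelLength, List.length_append, length_unary, h1, h2, List.length_ofFn,
    m.blocks_sum, List.length_singleton, Composition.blocks_length]
  omega

/-- The bits of `1^{σ,m}`; `length_labelList` shows that `k` is the number of parts of `m` in all
uses. -/
def label {n : ℕ} (k : ℕ) (σ : Equiv.Perm (Fin n)) (m : Composition n) :
    Fin (labelLength n k) → Bool :=
  fun i => (labelList σ m).getD i false

/-- The number `n²/2 + 7n/2 + k + 2` of input qubits of a distinguisher for length `n`. -/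
abbrev inputLength (n k : ℕ) : ℕ := labelLength n k + n

theorem two_mul_inputLength (n k : ℕ) : 2 * inputLength n k = n ^ 2 + 7 * n + 2 * k + 4 := by
  have h2 : 2 ∣ n * (n + 5) := by
    rw [show n * (n + 5) = n * (n + 1) + 2 * (2 * n) by ring]
    exact dvd_add (Nat.even_mul_succ_self n).two_dvd (Dvd.intro _ rfl)
  obtain ⟨c, hc⟩ := h2
  have : n ^ 2 + 5 * n = 2 * c := by rw [← hc]; ring
  simp only [inputLength, labelLength, hc]
  omega

/-- The state `|1^{σ,m}⟩|φ⟩`. -/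
def labelled {n : ℕ} (k : ℕ) (σ : Equiv.Perm (Fin n)) (m : Composition n) (φ : Qubits n) :
    Qubits (inputLength n k) :=
  WithLp.toLp 2 fun x =>
    if x ∘ Fin.castAdd n = label k σ m then φ (x ∘ Fin.natAdd (labelLength n k)) else 0

/-- The family `D` is a (non-uniform) entanglement `(k, ε)`-distinguisher of `ξ`. -/
def IsDistinguisher {𝒢 : Set Gate} {ℓ : ℕ → ℕ} (k : ℕ → ℕ) (ε : ℕ → ℝ) (ξ : ∀ n, Qustring (ℓ n))
    (D : ∀ n, Circuit 𝒢 (inputLength (ℓ n) (k n))) : Prop :=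
  ∀ᶠ n in atTop, ∀ (φ : Qustring (ℓ n)) (σ : Equiv.Perm (Fin (ℓ n))) (m : Composition (ℓ n)),
    m.length = k n → Achieves σ m φ →
      (D n).Distinguishes (ε n) (labelled (k n) σ m (ξ n).1) (labelled (k n) σ m φ.1)

/-- The ensemble `ξ` is (non-uniformly) `(k, ε, s)`-distinguishable from separable states, by
circuits over the gate set `𝒢`. -/
def Distinguishable (𝒢 : Set Gate) {ℓ : ℕ → ℕ} (k : ℕ → ℕ) (ε : ℕ → ℝ) (s : ℕ → ℕ)
    (ξ : ∀ n, Qustring (ℓ n)) : Prop :=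
  ∃ D : ∀ n, Circuit 𝒢 (inputLength (ℓ n) (k n)),
    IsDistinguisher k ε ξ D ∧ ∀ n, (D n).size ≤ s n

end QEnt

end

noncomputable section

namespace QEnt

/-! ## Elementary gates on a register -/

/-! The distinguisher is a projective measurement onto an approximation of `ξ`; it never looks at
the label. If it accepts `φ` with probability close to `|⟨ξ, φ⟩|²`, it accepts `ξ` with probability
close to 1. For separable `φ`, the trace distance of pure states is at most `√(1 - |⟨ξ, φ⟩|²)`
(`trNorm_sub_ketbra_le`), so being `δ`-far forces `|⟨ξ, φ⟩|² < 1 - δ²`. An error `ε / 8` in the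
modulus of the overlap leaves the required gap (`distinguishing_gap`).

What remains is to build the measurement from few gates. No approximate compilation of gates is
used: the state is approximated once, and the approximating state is then treated exactly. The
amplitudes of `2^j ξ` are rounded to Gaussian integers. Rounding destroys normalization, but a
further qubit restores it: the missing norm is a sum of four squares, hence the norm of two Gaussian
integers, placed where the new bit is 1 (`exists_completion`). Inputs `|0⟩|φ⟩` do not see these
entries. The result is a unit vector with amplitudes in `ℤ[i] / (1 + i)^(2j)`.

Such a vector is mapped exactly to a basis vector (`exists_reduction`). While the exponent is
positive, the norms of the numerators have even sum, so entries not divisible by `1 + i` come in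
pairs. A phase on one entry of a pair and a rotation in the plane of the two make both divisible
(`exists_pair_reduction`). After at most `2^M` such steps on `M` qubits a factor `1 + i` cancels; at
exponent 0 a single entry is left. Each step costs `O(M)` gates, because the rotations are
conjugates, by NOT, Hadamard and controlled-NOT, of the phase `i` on the all-ones string, and this
phase is obtained from a chain of Toffoli gates.

With `j = n + ⌈log₂ (1 / ε)⌉ + 4` the circuit has size `O(j n 2^n)`, which the growth hypothesis
bounds by `O(2^(2n))`, where `n` is the length of the qustring. -/

/-- The operator that reads the amplitude of `x` off at `g x`. -/
def reindex {ι : Type} (g : ι → ι) : EuclideanSpace ℂ ι →ₗ[ℂ] EuclideanSpace ℂ ι where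
  toFun v := WithLp.toLp 2 fun x => v (g x)
  map_add' _ _ := rfl
  map_smul' _ _ := rfl

@[simp] theorem reindex_apply {ι : Type} (g : ι → ι) (v : EuclideanSpace ℂ ι) (x : ι) :
    reindex g v x = v (g x) := rfl

/-- The diagonal operator with entries `f`. -/
def diagOp {ι : Type} (f : ι → ℂ) : EuclideanSpace ℂ ι →ₗ[ℂ] EuclideanSpace ℂ ι where
  toFun v := WithLp.toLp 2 fun x => f x * v x
  map_add' v w := by ext x; simp [mul_add]
  map_smul' c v := by ext x; simp [mul_left_comm]

@[simp] theorem diagOp_apply {ι : Type} (f : ι → ℂ) (v : EuclideanSpace ℂ ι) (x : ι) :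
    diagOp f v x = f x * v x := rfl

section Bits

variable {ω : Type} [DecidableEq ω]

/-- Negation of the bit `i`. -/
def flipBit (i : ω) (x : ω → Bool) : ω → Bool := Function.update x i (!x i)

/-- Negation of the bit `j` controlled by the bit `i`. -/
def cnotBit (i j : ω) (x : ω → Bool) : ω → Bool := Function.update x j (xor (x i) (x j))

/-- Negation of the bit `c` controlled by the bits `a` and `b`. -/
def toffoliBit (a b c : ω) (x : ω → Bool) : ω → Bool :=
  Function.update x c (xor (x a && x b) (x c))

@[simp] theorem flipBit_same (i : ω) (x : ω → Bool) : flipBit i x i = !x i := by simp [flipBit]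

theorem flipBit_of_ne {i j : ω} (h : j ≠ i) (x : ω → Bool) : flipBit i x j = x j := by
  simp [flipBit, h]

theorem flipBit_flipBit (i : ω) (x : ω → Bool) : flipBit i (flipBit i x) = x := by
  simp [flipBit]

@[simp] theorem cnotBit_same (i j : ω) (x : ω → Bool) : cnotBit i j x j = xor (x i) (x j) := by
  simp [cnotBit]

theorem cnotBit_of_ne (i : ω) {j l : ω} (h : l ≠ j) (x : ω → Bool) : cnotBit i j x l = x l := by
  simp [cnotBit, h]

theorem cnotBit_cnotBit {i j : ω} (h : i ≠ j) (x : ω → Bool) :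
    cnotBit i j (cnotBit i j x) = x := by
  simp [cnotBit, h]

@[simp] theorem toffoliBit_same (a b c : ω) (x : ω → Bool) :
    toffoliBit a b c x c = xor (x a && x b) (x c) := by
  simp [toffoliBit]

theorem toffoliBit_of_ne (a b : ω) {c l : ω} (h : l ≠ c) (x : ω → Bool) :
    toffoliBit a b c x l = x l := by
  simp [toffoliBit, h]

theorem toffoliBit_toffoliBit {a b c : ω} (ha : a ≠ c) (hb : b ≠ c) (x : ω → Bool) :
    toffoliBit a b c (toffoliBit a b c x) = x := by
  simp [toffoliBit, ha, hb]

/-- The sign `(-1)^b`. -/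
def bitSign (b : Bool) : ℂ := if b then -1 else 1

/-- The Hadamard operator on the qubit `i`. -/
def hadamardOp (i : ω) : EuclideanSpace ℂ (ω → Bool) →ₗ[ℂ] EuclideanSpace ℂ (ω → Bool) :=
  (((√2 : ℝ) : ℂ)⁻¹) • (diagOp (fun x => bitSign (x i)) + reindex (flipBit i))

theorem hadamardOp_apply (i : ω) (v : EuclideanSpace ℂ (ω → Bool)) (x : ω → Bool) :
    hadamardOp i v x = ((√2 : ℝ) : ℂ)⁻¹ * (bitSign (x i) * v x + v (flipBit i x)) := rfl

end Bits

theorem sqrt_two_inv_sq : ((√2 : ℝ) : ℂ)⁻¹ * ((√2 : ℝ) : ℂ)⁻¹ = 1 / 2 := by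
  rw [← mul_inv, ← Complex.ofReal_mul, Real.mul_self_sqrt (by norm_num)]
  norm_num

theorem sqrt_two_inv_mul_mul (z : ℂ) :
    ((√2 : ℝ) : ℂ)⁻¹ * (((√2 : ℝ) : ℂ)⁻¹ * z) = z / 2 := by
  rw [← mul_assoc, sqrt_two_inv_sq]; ring

theorem hadamardOp_hadamardOp {ω : Type} [DecidableEq ω] (i : ω)
    (v : EuclideanSpace ℂ (ω → Bool)) : hadamardOp i (hadamardOp i v) = v := by
  ext x
  simp only [hadamardOp_apply, flipBit_same, flipBit_flipBit]
  rw [mul_left_comm, ← mul_add, sqrt_two_inv_mul_mul]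
  cases x i <;> simp [bitSign] <;> ring

/-- The wire `i` as the placement of a one-qubit gate. -/
def oneWire {W : ℕ} (i : Fin W) : Fin 1 ↪ Fin W := ⟨fun _ => i, fun _ _ _ => Subsingleton.elim _ _⟩

/-- The wires `i`, `j` as the placement of a two-qubit gate. -/
def twoWires {W : ℕ} (i j : Fin W) (h : i ≠ j) : Fin 2 ↪ Fin W :=
  ⟨![i, j], by
    intro a b
    fin_cases a <;> fin_cases b <;> simp [h, h.symm]⟩

@[simp] theorem oneWire_apply {W : ℕ} (i : Fin W) (a : Fin 1) : oneWire i a = i := rfl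

@[simp] theorem twoWires_zero {W : ℕ} (i j : Fin W) (h : i ≠ j) : twoWires i j h 0 = i := rfl

@[simp] theorem twoWires_one {W : ℕ} (i j : Fin W) (h : i ≠ j) : twoWires i j h 1 = j := rfl

theorem single_apply {W : ℕ} (U : Matrix Bool Bool ℂ) (hU) (i : Fin W) (v : Qubits W)
    (x : Fin W → Bool) :
    (Gate.single U hU).apply (oneWire i) v x =
      U (x i) false * v (Function.update x i false) +
        U (x i) true * v (Function.update x i true) := by
  have hext : ∀ y : Fin 1 → Bool,
      Function.extend (oneWire i) y x = Function.update x i (y 0) := by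
    intro y
    ext j
    by_cases h : j = i
    · subst h
      have := (oneWire j).injective.extend_apply y x 0
      simpa using this
    · rw [Function.extend_apply', Function.update_of_ne h]
      rintro ⟨_, rfl⟩
      exact h rfl
  change ∑ y : Fin 1 → Bool, U (x i) (y 0) * v (Function.extend (oneWire i) y x) = _
  simp only [hext]
  rw [← (Equiv.funUnique (Fin 1) Bool).symm.sum_comp]
  simp [add_comm]

theorem notGate_apply {W : ℕ} (i : Fin W) (v : Qubits W) :
    notGate.apply (oneWire i) v = reindex (flipBit i) v := by
  ext x
  refine (single_apply _ _ i v x).trans ?_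
  rw [reindex_apply, flipBit]
  cases x i <;> simp

theorem tGate_apply {W : ℕ} (i : Fin W) (v : Qubits W) :
    tGate.apply (oneWire i) v =
      diagOp (fun x => if x i then Complex.exp ((Real.pi / 4 : ℝ) * Complex.I) else 1) v := by
  ext x
  refine (single_apply _ _ i v x).trans ?_
  rw [diagOp_apply]
  have h := Function.update_eq_self i x
  cases hx : x i <;> rw [hx] at h <;> simp [h]

theorem hadamardGate_apply {W : ℕ} (i : Fin W) (v : Qubits W) :
    hadamardGate.apply (oneWire i) v = hadamardOp i v := by
  ext x
  refine (single_apply _ _ i v x).trans ?_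
  rw [hadamardOp_apply, flipBit]
  have h := Function.update_eq_self i x
  cases hx : x i <;> rw [hx] at h <;> simp [h, bitSign, div_eq_inv_mul] <;> ring

theorem cnotGate_apply {W : ℕ} (i j : Fin W) (h : i ≠ j) (v : Qubits W) :
    cnotGate.apply (twoWires i j h) v = reindex (cnotBit i j) v := by
  ext x
  change ∑ y : Fin 2 → Bool, (if x ∘ twoWires i j h = ![y 0, xor (y 0) (y 1)] then (1 : ℂ) else 0) *
    v (Function.extend (twoWires i j h) y x) = v (cnotBit i j x)
  rw [Finset.sum_eq_single ![x i, xor (x i) (x j)]]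
  · have e1 : x ∘ twoWires i j h = ![x i, x j] := by
      ext a; fin_cases a <;> simp
    have e2 : Function.extend (twoWires i j h) ![x i, xor (x i) (x j)] x = cnotBit i j x := by
      ext l
      by_cases hj : l = j
      · subst hj
        have := (twoWires i l h).injective.extend_apply ![x i, xor (x i) (x l)] x 1
        simpa [cnotBit] using this
      · rw [cnotBit_of_ne _ hj]
        by_cases hi : l = i
        · subst hi
          have := (twoWires l j h).injective.extend_apply ![x l, xor (x l) (x j)] x 0
          simpa [cnotBit] using this
        · rw [Function.extend_apply']
          rintro ⟨a, rfl⟩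
          fin_cases a <;> simp at hi hj
    rw [e2, e1]
    simp
  · intro y _ hy
    rw [if_neg, zero_mul]
    intro e
    apply hy
    have e0 := congrFun e 0
    have e1 := congrFun e 1
    simp only [Function.comp_apply, twoWires_zero, twoWires_one, Matrix.cons_val_zero,
      Matrix.cons_val_one] at e0 e1
    ext a
    fin_cases a
    · simp [e0]
    · simp [e0, e1]
  · simp

/-! ## Operators implemented by gate sequences -/

/-- A gate placed on the wires of a register. -/
abbrev PlacedGate (W : ℕ) : Type 0 := Σ g : Gate, Fin g.arity ↪ Fin W

/-- The action of a sequence of placed gates. -/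
def runOps {W : ℕ} (L : List (PlacedGate W)) (v : Qubits W) : Qubits W :=
  L.foldl (fun v o => o.1.apply o.2 v) v

theorem runOps_append {W : ℕ} (L L' : List (PlacedGate W)) (v : Qubits W) :
    runOps (L ++ L') v = runOps L' (runOps L v) := List.foldl_append ..

/-- The operator `F` is the action of a sequence of at most `c` gates from `𝒢`. -/
def Implements (𝒢 : Set Gate) {W : ℕ} (c : ℕ) (F : Qubits W → Qubits W) : Prop :=
  ∃ L : List (PlacedGate W), (∀ o ∈ L, o.1 ∈ 𝒢) ∧ L.length ≤ c ∧ ∀ v, runOps L v = F v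

namespace Implements

variable {𝒢 : Set Gate} {W : ℕ} {F G : Qubits W → Qubits W} {c c' : ℕ}

theorem of_apply {g : Gate} (hg : g ∈ 𝒢) (e : Fin g.arity ↪ Fin W) (h : ∀ v, g.apply e v = F v) :
    Implements 𝒢 1 F :=
  ⟨[⟨g, e⟩], by simpa using hg, by simp, fun v => h v⟩

theorem id : Implements 𝒢 (W := W) 0 fun v => v := ⟨[], by simp, by simp, fun _ => rfl⟩

theorem comp (hF : Implements 𝒢 c F) (hG : Implements 𝒢 c' G) :
    Implements 𝒢 (c + c') fun v => G (F v) := by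
  obtain ⟨L, h1, h2, h3⟩ := hF
  obtain ⟨L', h1', h2', h3'⟩ := hG
  refine ⟨L ++ L', ?_, by simpa using add_le_add h2 h2', fun v => ?_⟩
  · intro o ho
    rcases List.mem_append.1 ho with h | h
    exacts [h1 o h, h1' o h]
  · rw [runOps_append, h3, h3']

theorem congr (hF : Implements 𝒢 c F) (h : ∀ v, F v = G v) : Implements 𝒢 c G := by
  rwa [← funext h]

theorem mono (hF : Implements 𝒢 c F) (h : c ≤ c') : Implements 𝒢 c' F := by
  obtain ⟨L, h1, h2, h3⟩ := hF
  exact ⟨L, h1, h2.trans h, h3⟩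

theorem diagOp_pow {f : (Fin W → Bool) → ℂ} (h : Implements 𝒢 c (diagOp f)) (n : ℕ) :
    Implements 𝒢 (n * c) (diagOp fun x => f x ^ n) := by
  induction n with
  | zero => exact (id.congr fun v => by ext x; simp).mono (by simp)
  | succ n ih =>
    refine ((ih.comp h).congr fun v => ?_).mono (by rw [Nat.succ_mul])
    ext x
    simp only [diagOp_apply]
    ring

theorem diagOp_mul {f g : (Fin W → Bool) → ℂ} (hf : Implements 𝒢 c (diagOp f))
    (hg : Implements 𝒢 c' (diagOp g)) : Implements 𝒢 (c + c') (diagOp fun x => f x * g x) := by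
  refine (hf.comp hg).congr fun v => ?_
  ext x
  simp only [diagOp_apply]
  ring

/-- Conjugation of a diagonal operator by a reversible classical computation. -/
theorem diagOp_conj {f : (Fin W → Bool) → ℂ} {g g' : (Fin W → Bool) → Fin W → Bool}
    {c₁ c₂ : ℕ} (hf : Implements 𝒢 c (diagOp f)) (hg' : Implements 𝒢 c₁ (reindex g'))
    (hg : Implements 𝒢 c₂ (reindex g)) (h : ∀ x, g' (g x) = x) :
    Implements 𝒢 (c₁ + c + c₂) (diagOp fun x => f (g x)) := by
  refine ((hg'.comp hf).comp hg).congr fun v => ?_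
  ext x
  simp [h]

end Implements

/-! ### The Toffoli gate from Hadamard, `T` and controlled-NOT. -/

theorem implements_flipBit {𝒢 : Set Gate} (h𝒢 : IsStandardGateSet 𝒢) {W : ℕ} (i : Fin W) :
    Implements 𝒢 1 (reindex (flipBit i)) :=
  .of_apply h𝒢.not_mem (oneWire i) (notGate_apply i)

theorem implements_cnotBit {𝒢 : Set Gate} (h𝒢 : IsStandardGateSet 𝒢) {W : ℕ} {i j : Fin W}
    (h : i ≠ j) : Implements 𝒢 1 (reindex (cnotBit i j)) :=
  .of_apply h𝒢.cnot_mem (twoWires i j h) (cnotGate_apply i j h)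

theorem implements_hadamardOp {𝒢 : Set Gate} (h𝒢 : IsStandardGateSet 𝒢) {W : ℕ} (i : Fin W) :
    Implements 𝒢 1 (hadamardOp i) :=
  .of_apply h𝒢.hadamard_mem (oneWire i) (hadamardGate_apply i)

/-- The phase `e^{iπ/4}`. -/
def omega8 : ℂ := Complex.exp ((Real.pi / 4 : ℝ) * Complex.I)

theorem omega8_sq : omega8 ^ 2 = Complex.I := by
  rw [omega8, ← Complex.exp_nat_mul]
  rw [show ((2 : ℕ) : ℂ) * ((Real.pi / 4 : ℝ) * Complex.I) = Real.pi / 2 * Complex.I by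
    push_cast; ring]
  exact Complex.exp_pi_div_two_mul_I

theorem omega8_pow_four : omega8 ^ 4 = -1 := by
  rw [show omega8 ^ 4 = (omega8 ^ 2) ^ 2 by ring, omega8_sq, Complex.I_sq]

theorem omega8_pow_eight : omega8 ^ 8 = 1 := by
  rw [show omega8 ^ 8 = (omega8 ^ 4) ^ 2 by ring, omega8_pow_four]; norm_num

/-- The power of the phase `e^{iπ/4}` with exponent a bit. -/
def bitPhase (b : Bool) : ℂ := if b then omega8 else 1

theorem implements_bitPhase {𝒢 : Set Gate} (h𝒢 : IsStandardGateSet 𝒢) {W : ℕ} (i : Fin W) :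
    Implements 𝒢 1 (diagOp fun x => bitPhase (x i)) :=
  .of_apply h𝒢.t_mem (oneWire i) (tGate_apply i)

theorem implements_phase_xor {𝒢 : Set Gate} (h𝒢 : IsStandardGateSet 𝒢) {W : ℕ} {i j : Fin W}
    (h : i ≠ j) : Implements 𝒢 3 (diagOp fun x => bitPhase (xor (x i) (x j))) := by
  have := (implements_bitPhase h𝒢 j).diagOp_conj (implements_cnotBit h𝒢 h)
    (implements_cnotBit h𝒢 h) (cnotBit_cnotBit h)
  simpa using this

theorem implements_phase_xor_xor {𝒢 : Set Gate} (h𝒢 : IsStandardGateSet 𝒢) {W : ℕ}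
    {i j l : Fin W} (hil : i ≠ l) (hjl : j ≠ l) :
    Implements 𝒢 5 (diagOp fun x => bitPhase (xor (x i) (xor (x j) (x l)))) := by
  have := (implements_phase_xor h𝒢 hjl).diagOp_conj (implements_cnotBit h𝒢 hil)
    (implements_cnotBit h𝒢 hil) (cnotBit_cnotBit hil)
  refine this.congr fun v => ?_
  ext x
  simp only [diagOp_apply, cnotBit_same, cnotBit_of_ne _ hjl]
  congr 2
  cases x i <;> cases x j <;> cases x l <;> rfl

/-- For bits, `4abc = a + b + c - (a ⊕ b) - (a ⊕ c) - (b ⊕ c) + (a ⊕ b ⊕ c)`, and `omega8 ^ 4 = -1`.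
Seventh powers stand for inverses, so that only `T` itself is needed as a gate. -/
theorem bitSign_and_and (a b c : Bool) :
    bitSign (a && b && c) = bitPhase a * bitPhase b * bitPhase c * bitPhase (xor a b) ^ 7 *
      bitPhase (xor a c) ^ 7 * bitPhase (xor b c) ^ 7 * bitPhase (xor a (xor b c)) := by
  have h4 := omega8_pow_four
  have h8 := omega8_pow_eight
  have h16 : omega8 ^ 16 = 1 := by
    rw [show omega8 ^ 16 = (omega8 ^ 8) ^ 2 by ring, h8]; norm_num
  cases a <;> cases b <;> cases c <;> simp [bitSign, bitPhase]
  all_goals first | linear_combination -h16 | linear_combination h4 - h16 | linear_combination -h4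

theorem implements_ccz {𝒢 : Set Gate} (h𝒢 : IsStandardGateSet 𝒢) {W : ℕ}
    {a b c : Fin W} (hab : a ≠ b) (hac : a ≠ c) (hbc : b ≠ c) :
    Implements 𝒢 71 (diagOp fun x => bitSign (x a && x b && x c)) := by
  have := ((((((implements_bitPhase h𝒢 a).diagOp_mul (implements_bitPhase h𝒢 b)).diagOp_mul
    (implements_bitPhase h𝒢 c)).diagOp_mul ((implements_phase_xor h𝒢 hab).diagOp_pow 7)).diagOp_mul
    ((implements_phase_xor h𝒢 hac).diagOp_pow 7)).diagOp_mul
    ((implements_phase_xor h𝒢 hbc).diagOp_pow 7)).diagOp_mul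
    (implements_phase_xor_xor h𝒢 hac hbc)
  simp only [bitSign_and_and]
  exact this

/-- Conjugation by Hadamard on the target `c` turns a conditional sign into a conditional negation.
-/
theorem implements_toffoliBit {𝒢 : Set Gate} (h𝒢 : IsStandardGateSet 𝒢) {W : ℕ}
    {a b c : Fin W} (hab : a ≠ b) (hac : a ≠ c) (hbc : b ≠ c) :
    Implements 𝒢 73 (reindex (toffoliBit a b c)) := by
  refine (((implements_hadamardOp h𝒢 c).comp (implements_ccz h𝒢 hab hac hbc)).comp
    (implements_hadamardOp h𝒢 c)).congr fun v => ?_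
  ext x
  simp only [hadamardOp_apply, diagOp_apply, reindex_apply, flipBit_same, flipBit_flipBit,
    flipBit_of_ne hac, flipBit_of_ne hbc]
  have hx : toffoliBit a b c x = if x a && x b then flipBit c x else x := by
    cases hab' : x a && x b <;> simp [toffoliBit, hab', flipBit]
  rw [hx]
  simp only [mul_left_comm _ (((√2 : ℝ) : ℂ)⁻¹)]
  rw [← mul_add, sqrt_two_inv_mul_mul]
  cases x a && x b <;> cases x c <;> simp [bitSign] <;> ring

end QEnt
end

noncomputable section

namespace QEnt

/-! ## Phase rotations about a vector -/

/-- The operator that multiplies the component along `a` by `i`. -/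
def phaseAlong {E : Type} [NormedAddCommGroup E] [InnerProductSpace ℂ E] (a v : E) : E :=
  v + ((Complex.I - 1) * inner ℂ a v) • a

section PhaseAlong

variable {E : Type} [NormedAddCommGroup E] [InnerProductSpace ℂ E]

/-- The cross terms cancel because `|i - 1|² + 2 Re (i - 1) = 0`. -/
theorem inner_phaseAlong {a : E} (ha : ‖a‖ = 1) (v w : E) :
    inner ℂ (phaseAlong a v) (phaseAlong a w) = inner ℂ v w := by
  have haa : inner ℂ a a = (1 : ℂ) := by
    rw [inner_self_eq_norm_sq_to_K, ha]; norm_num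
  simp only [phaseAlong, inner_add_left, inner_add_right, inner_smul_left, inner_smul_right, haa,
    map_mul, map_sub, map_one, Complex.conj_I, inner_conj_symm]
  linear_combination (-(inner ℂ a w * inner ℂ v a)) * Complex.I_sq

/-- Conjugation by a symmetric involution. -/
theorem conj_phaseAlong {Q : E →ₗ[ℂ] E} (hQ : Q.IsSymmetric) (hQQ : ∀ v, Q (Q v) = v) (a v : E) :
    Q (phaseAlong a (Q v)) = phaseAlong (Q a) v := by
  simp only [phaseAlong, map_add, map_smul, hQQ, hQ a v]

end PhaseAlong

theorem reindex_isSymmetric {ι : Type} [Fintype ι] {g : ι → ι} (hg : Function.Involutive g) :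
    (reindex g).IsSymmetric := by
  intro v w
  simp only [PiLp.inner_apply, reindex_apply]
  rw [← Equiv.sum_comp (hg.toPerm g)]
  simp [hg _]

theorem reindex_single {ι : Type} [DecidableEq ι] {g : ι → ι} (hg : Function.Involutive g)
    (x : ι) (c : ℂ) :
    reindex g (EuclideanSpace.single x c) = EuclideanSpace.single (g x) c := by
  ext y
  simp [PiLp.single_apply, hg.eq_iff]

theorem hadamardOp_isSymmetric {ω : Type} [DecidableEq ω] [Fintype ω] (i : ω) :
    (hadamardOp i).IsSymmetric := by
  have hd : (diagOp fun x : ω → Bool => bitSign (x i)).IsSymmetric := by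
    intro v w
    simp only [PiLp.inner_apply, diagOp_apply]
    refine Finset.sum_congr rfl fun x _ => ?_
    cases x i <;> simp [bitSign]
  refine LinearMap.IsSymmetric.smul ?_ (hd.add (reindex_isSymmetric (flipBit_flipBit i)))
  simp

theorem hadamardOp_single {ω : Type} [DecidableEq ω] [Fintype ω] (i : ω) (x : ω → Bool) (hx : x i = false) :
    hadamardOp i (EuclideanSpace.single x 1) = ((√2 : ℝ) : ℂ)⁻¹ •
      (EuclideanSpace.single x 1 + EuclideanSpace.single (flipBit i x) 1) := by
  ext y
  simp only [hadamardOp_apply, PiLp.smul_apply, PiLp.add_apply, PiLp.single_apply, smul_eq_mul]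
  have h : flipBit i y = x ↔ y = flipBit i x :=
    Function.Involutive.eq_iff (flipBit_flipBit i)
  by_cases hy : y = x
  · subst hy
    simp [hx, bitSign, h]
  · simp [hy, h]

/-! ## Data wires and work wires -/

/-- A choice of data wires and of work wires in a register. -/
structure Layout (M W : ℕ) where
  data : Fin M ↪ Fin W
  work : Fin (M + 1) ↪ Fin W
  disjoint : ∀ i j, data i ≠ work j

variable {M W : ℕ}

/-- The state with the data wires in the state `v` and the bits of `r` on the other wires. -/
def Layout.encode (Λ : Layout M W) (r : Fin W → Bool) (v : Qubits M) : Qubits W :=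
  open Classical in
  WithLp.toLp 2 fun x => if ∀ i, i ∉ Set.range Λ.data → x i = r i then v (x ∘ Λ.data) else 0

theorem Layout.encode_apply_of (Λ : Layout M W) {r x : Fin W → Bool} (v : Qubits M)
    (h : ∀ i, i ∉ Set.range Λ.data → x i = r i) : Λ.encode r v x = v (x ∘ Λ.data) :=
  if_pos h

theorem Layout.encode_apply_of_not (Λ : Layout M W) {r x : Fin W → Bool} (v : Qubits M)
    (h : ¬ ∀ i, i ∉ Set.range Λ.data → x i = r i) : Λ.encode r v x = 0 :=
  if_neg h

theorem Layout.work_notMem_range (Λ : Layout M W) (j : Fin (M + 1)) :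
    Λ.work j ∉ Set.range Λ.data := by
  rintro ⟨i, hi⟩
  exact Λ.disjoint i j hi

/-- The work wires carry the bit 0. -/
def Layout.Clean (Λ : Layout M W) (x : Fin W → Bool) : Prop := ∀ j, x (Λ.work j) = false

/-- On states with clean work wires, the operator `U` on the data wires is the action of at most
`c` gates of `𝒢`. -/
def Realizes (𝒢 : Set Gate) (Λ : Layout M W) (c : ℕ) (U : Qubits M → Qubits M) : Prop :=
  ∃ L : List (PlacedGate W), (∀ o ∈ L, o.1 ∈ 𝒢) ∧ L.length ≤ c ∧
    ∀ r, Λ.Clean r → ∀ v, runOps L (Λ.encode r v) = Λ.encode r (U v)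

namespace Realizes

variable {𝒢 : Set Gate} {Λ : Layout M W} {U V : Qubits M → Qubits M} {c c' : ℕ}

theorem of_implements {F : Qubits W → Qubits W} (hF : Implements 𝒢 c F)
    (h : ∀ r, Λ.Clean r → ∀ v, F (Λ.encode r v) = Λ.encode r (U v)) : Realizes 𝒢 Λ c U := by
  obtain ⟨L, h1, h2, h3⟩ := hF
  exact ⟨L, h1, h2, fun r hr v => by rw [h3, h r hr]⟩

theorem id : Realizes 𝒢 Λ 0 fun v => v := ⟨[], by simp, by simp, fun _ _ _ => rfl⟩

theorem comp (hU : Realizes 𝒢 Λ c U) (hV : Realizes 𝒢 Λ c' V) :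
    Realizes 𝒢 Λ (c + c') fun v => V (U v) := by
  obtain ⟨L, h1, h2, h3⟩ := hU
  obtain ⟨L', h1', h2', h3'⟩ := hV
  refine ⟨L ++ L', ?_, by simpa using add_le_add h2 h2', fun r hr v => ?_⟩
  · intro o ho
    rcases List.mem_append.1 ho with h | h
    exacts [h1 o h, h1' o h]
  · rw [runOps_append, h3 r hr, h3' r hr]

theorem congr (hU : Realizes 𝒢 Λ c U) (h : ∀ v, U v = V v) : Realizes 𝒢 Λ c V := by
  rwa [← funext h]

theorem mono (hU : Realizes 𝒢 Λ c U) (h : c ≤ c') : Realizes 𝒢 Λ c' U := by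
  obtain ⟨L, h1, h2, h3⟩ := hU
  exact ⟨L, h1, h2.trans h, h3⟩

/-- A classical computation on the data wires. -/
theorem reindex {g : (Fin W → Bool) → Fin W → Bool} {g' : (Fin M → Bool) → Fin M → Bool}
    (hg : Implements 𝒢 c (reindex g)) (h1 : ∀ x i, i ∉ Set.range Λ.data → g x i = x i)
    (h2 : ∀ x, g x ∘ Λ.data = g' (x ∘ Λ.data)) : Realizes 𝒢 Λ c (QEnt.reindex g') := by
  refine of_implements hg fun r _ v => ?_
  ext x
  rw [reindex_apply]
  by_cases h : ∀ i, i ∉ Set.range Λ.data → x i = r i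
  · rw [Λ.encode_apply_of _ h, Λ.encode_apply_of _ fun i hi => (h1 x i hi).trans (h i hi),
      reindex_apply, h2]
  · rw [Λ.encode_apply_of_not _ h, Λ.encode_apply_of_not]
    exact fun h' => h fun i hi => (h1 x i hi).symm.trans (h' i hi)

/-- The engine of the construction: a rotation about one vector yields rotations about its images
under cheap symmetric involutions, at twice their cost. -/
theorem conj {Q : Qubits M →ₗ[ℂ] Qubits M} {a : Qubits M} (hR : Realizes 𝒢 Λ c (phaseAlong a))
    (hQ : Realizes 𝒢 Λ c' Q) (hs : Q.IsSymmetric) (hQQ : ∀ v, Q (Q v) = v) :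
    Realizes 𝒢 Λ (c + 2 * c') (phaseAlong (Q a)) :=
  (((hQ.comp hR).comp hQ).congr fun v => conj_phaseAlong hs hQQ a v).mono (by omega)

end Realizes

theorem flipBit_comp_data (Λ : Layout M W) (i : Fin M) (x : Fin W → Bool) :
    flipBit (Λ.data i) x ∘ Λ.data = flipBit i (x ∘ Λ.data) := by
  ext j
  by_cases h : j = i
  · subst h; simp
  · rw [flipBit_of_ne h, Function.comp_apply, Function.comp_apply,
      flipBit_of_ne (Λ.data.injective.ne h)]

theorem cnotBit_comp_data (Λ : Layout M W) (i j : Fin M) (x : Fin W → Bool) :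
    cnotBit (Λ.data i) (Λ.data j) x ∘ Λ.data = cnotBit i j (x ∘ Λ.data) := by
  ext l
  by_cases h : l = j
  · subst h; simp
  · rw [cnotBit_of_ne _ h, Function.comp_apply, Function.comp_apply,
      cnotBit_of_ne _ (Λ.data.injective.ne h)]

section Standard

variable {𝒢 : Set Gate} (Λ : Layout M W)

theorem realizes_flipBit (h𝒢 : IsStandardGateSet 𝒢) (i : Fin M) :
    Realizes 𝒢 Λ 1 (reindex (flipBit i)) :=
  .reindex (implements_flipBit h𝒢 (Λ.data i))
    (fun x _ hj => flipBit_of_ne (fun h => hj ⟨i, h.symm⟩) x) (flipBit_comp_data Λ i)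

theorem realizes_cnotBit (h𝒢 : IsStandardGateSet 𝒢) {i j : Fin M} (h : i ≠ j) :
    Realizes 𝒢 Λ 1 (reindex (cnotBit i j)) :=
  .reindex (implements_cnotBit h𝒢 (Λ.data.injective.ne h))
    (fun x _ hl => cnotBit_of_ne _ (fun h => hl ⟨j, h.symm⟩) x) (cnotBit_comp_data Λ i j)

theorem realizes_hadamardOp (h𝒢 : IsStandardGateSet 𝒢) (i : Fin M) :
    Realizes 𝒢 Λ 1 (hadamardOp i) := by
  refine .of_implements (implements_hadamardOp h𝒢 (Λ.data i)) fun r _ v => ?_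
  ext x
  have hf : ∀ j, j ∉ Set.range Λ.data → flipBit (Λ.data i) x j = x j :=
    fun j hj => flipBit_of_ne (fun h => hj ⟨i, h.symm⟩) x
  rw [hadamardOp_apply]
  by_cases h : ∀ i, i ∉ Set.range Λ.data → x i = r i
  · rw [Λ.encode_apply_of _ h, Λ.encode_apply_of _ fun i hi => (hf i hi).trans (h i hi),
      Λ.encode_apply_of _ h, hadamardOp_apply, flipBit_comp_data]
    rfl
  · rw [Λ.encode_apply_of_not _ h, Λ.encode_apply_of_not _ h, Λ.encode_apply_of_not]
    · simp
    · exact fun h' => h fun i hi => (hf i hi).symm.trans (h' i hi)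

/-! ## The conjunction of the data bits -/

/-- Work wire 0 is set to 1, the empty conjunction; then a Toffoli gate on work wire `m` and data
wire `m` writes the next partial conjunction on work wire `m + 1`. Since `reindex π` reads
amplitudes at `π x`, the operator sending the basis state of `x` to that of `π x` is `reindex
π.symm`; both directions are recorded, for computing and uncomputing. -/
theorem exists_partial_flag (h𝒢 : IsStandardGateSet 𝒢) (m : ℕ) (hm : m ≤ M) :
    ∃ π : Equiv.Perm (Fin W → Bool),
      Implements 𝒢 (73 * m + 1) (reindex π) ∧ Implements 𝒢 (73 * m + 1) (reindex π.symm) ∧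
      ∀ x, Λ.Clean x → (∀ i, π x (Λ.data i) = x (Λ.data i)) ∧
        (∀ j : Fin (M + 1), m < j → π x (Λ.work j) = false) ∧
        (π x (Λ.work ⟨m, by omega⟩) = true ↔ ∀ i : Fin M, (i : ℕ) < m → x (Λ.data i) = true) := by
  induction m with
  | zero =>
    refine ⟨Function.Involutive.toPerm _ (flipBit_flipBit (Λ.work 0)),
      implements_flipBit h𝒢 _, implements_flipBit h𝒢 _, fun x hx => ⟨fun i => ?_, fun j hj => ?_, ?_⟩⟩
    · exact flipBit_of_ne (Λ.disjoint i 0) x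
    · refine (flipBit_of_ne (Λ.work.injective.ne ?_) x).trans (hx j)
      rintro rfl
      simp at hj
    · have := flipBit_same (Λ.work 0) x
      rw [hx 0] at this
      exact iff_of_true this (by simp)
  | succ m ih =>
    obtain ⟨π, h1, h2, h3⟩ := ih (by omega)
    have hac : Λ.work ⟨m, by omega⟩ ≠ Λ.work ⟨m + 1, by omega⟩ := Λ.work.injective.ne (by simp)
    have hbc := Λ.disjoint ⟨m, by omega⟩ ⟨m + 1, by omega⟩
    have hab := (Λ.disjoint ⟨m, by omega⟩ ⟨m, by omega⟩).symm
    have ht := implements_toffoliBit h𝒢 hab hac hbc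
    refine ⟨π.trans (Function.Involutive.toPerm _ (toffoliBit_toffoliBit hac hbc)),
      (ht.comp h1).mono (by omega), (h2.comp ht).mono (by omega), fun x hx => ?_⟩
    obtain ⟨g1, g2, g3⟩ := h3 x hx
    refine ⟨fun i => ?_, fun j hj => ?_, ?_⟩
    · exact (toffoliBit_of_ne _ _ (Λ.disjoint i _) _).trans (g1 i)
    · refine (toffoliBit_of_ne _ _ (Λ.work.injective.ne ?_) _).trans (g2 j (by omega))
      rintro rfl
      simp at hj
    · have := toffoliBit_same (Λ.work ⟨m, by omega⟩) (Λ.data ⟨m, by omega⟩)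
        (Λ.work ⟨m + 1, by omega⟩) (π x)
      rw [g2 ⟨m + 1, by omega⟩ (by simp), g1] at this
      change toffoliBit _ _ _ (π x) _ = true ↔ _
      rw [this]
      simp only [Bool.xor_false, Bool.and_eq_true, g3]
      constructor
      · rintro ⟨ha, hb⟩ i hi
        rcases Nat.lt_succ_iff_lt_or_eq.1 hi with h | h
        · exact ha i h
        · rwa [show i = ⟨m, by omega⟩ from Fin.ext h]
      · exact fun h => ⟨fun i hi => h i (by omega), h _ (by simp)⟩

/-- A reversible computation of the conjunction of the data bits, into the last work wire. -/
theorem exists_flag (h𝒢 : IsStandardGateSet 𝒢) :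
    ∃ π : Equiv.Perm (Fin W → Bool),
      Implements 𝒢 (73 * M + 1) (reindex π) ∧ Implements 𝒢 (73 * M + 1) (reindex π.symm) ∧
      ∀ x, Λ.Clean x → (π x (Λ.work (Fin.last M)) = true ↔ x ∘ Λ.data = fun _ => true) := by
  obtain ⟨π, h1, h2, h3⟩ := exists_partial_flag Λ h𝒢 M le_rfl
  refine ⟨π, h1, h2, fun x hx => (h3 x hx).2.2.trans ?_⟩
  simp [funext_iff]

/-! ### Rotations about basis vectors and about normalized sums of two basis vectors. -/

theorem phaseAlong_single_apply {ι : Type} [Fintype ι] [DecidableEq ι] (z : ι)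
    (v : EuclideanSpace ℂ ι) (x : ι) :
    phaseAlong (EuclideanSpace.single z 1) v x = (if x = z then Complex.I else 1) * v x := by
  simp only [phaseAlong, PiLp.add_apply, PiLp.smul_apply, PiLp.single_apply,
    EuclideanSpace.inner_single_left, map_one, smul_eq_mul]
  split_ifs with h
  · subst h; ring
  · ring

/-- Compute the conjunction, apply `T` twice to it (the phase `i` on the bit 1), uncompute. -/
theorem realizes_phaseAlong_true (h𝒢 : IsStandardGateSet 𝒢) :
    Realizes 𝒢 Λ (146 * M + 4) (phaseAlong (EuclideanSpace.single (fun _ => true) 1)) := by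
  obtain ⟨π, h1, h2, h3⟩ := exists_flag Λ h𝒢
  have key := ((implements_bitPhase h𝒢 (Λ.work (Fin.last M))).diagOp_pow 2).diagOp_conj h2 h1
    π.symm_apply_apply
  refine (Realizes.of_implements key fun r hr v => ?_).mono (by omega)
  ext x
  rw [diagOp_apply]
  by_cases h : ∀ i, i ∉ Set.range Λ.data → x i = r i
  · rw [Λ.encode_apply_of _ h, Λ.encode_apply_of _ h, phaseAlong_single_apply]
    have hx : Λ.Clean x := fun j => (h _ (Λ.work_notMem_range j)).trans (hr j)
    congr 1
    by_cases hz : x ∘ Λ.data = fun _ => true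
    · rw [if_pos hz, (h3 x hx).2 hz, bitPhase, if_pos rfl, omega8_sq]
    · rw [if_neg hz, Bool.eq_false_iff.2 fun h => hz ((h3 x hx).1 h)]
      simp [bitPhase]
  · rw [Λ.encode_apply_of_not _ h, Λ.encode_apply_of_not _ h, mul_zero]

/-- Bit strings are reached from the string of ones by negations. -/
theorem exists_reindex_single_true (h𝒢 : IsStandardGateSet 𝒢) (z : Fin M → Bool) :
    ∃ g : (Fin M → Bool) → Fin M → Bool, Function.Involutive g ∧ g z = (fun _ => true) ∧
      Realizes 𝒢 Λ M (reindex g) := by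
  have key : ∀ s : Finset (Fin M), Realizes 𝒢 Λ s.card
      (reindex fun x : Fin M → Bool => fun i => if i ∈ s then !x i else x i) := by
    intro s
    induction s using Finset.induction_on with
    | empty => exact Realizes.id.congr fun v => by ext x; simp
    | insert a s ha ih =>
      refine ((ih.comp (realizes_flipBit Λ h𝒢 a)).congr fun v => ?_).mono
        (Finset.card_insert_of_notMem ha).ge
      ext x
      simp only [reindex_apply]
      refine congrArg v.ofLp (funext fun i => ?_)
      by_cases h : i = a
      · subst h; simp [ha]
      · simp [h, flipBit_of_ne h]
  refine ⟨_, fun x => ?_, ?_, (key (Finset.univ.filter fun i => z i = false)).mono ?_⟩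
  · ext i
    simp only
    split_ifs <;> simp
  · ext i
    cases h : z i <;> simp [h]
  · simpa using Finset.card_le_univ (Finset.univ.filter fun i => z i = false)

theorem realizes_phaseAlong_single (h𝒢 : IsStandardGateSet 𝒢) (z : Fin M → Bool) :
    Realizes 𝒢 Λ (148 * M + 4) (phaseAlong (EuclideanSpace.single z 1)) := by
  obtain ⟨g, hg, hz, hr⟩ := exists_reindex_single_true Λ h𝒢 z
  have := (realizes_phaseAlong_true Λ h𝒢).conj hr (reindex_isSymmetric hg)
    (fun v => by ext x; simp [hg x])
  rw [reindex_single hg, ← hz, hg] at this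
  exact this.mono (by omega)

/-- The normalized sum of two basis vectors. -/
def pairVector {ι : Type} [DecidableEq ι] (x y : ι) : EuclideanSpace ℂ ι :=
  ((√2 : ℝ) : ℂ)⁻¹ • (EuclideanSpace.single x 1 + EuclideanSpace.single y 1)

theorem pairVector_comm {ι : Type} [DecidableEq ι] (x y : ι) :
    pairVector x y = pairVector y x := by
  rw [pairVector, pairVector, add_comm]

theorem reindex_pairVector {ι : Type} [DecidableEq ι] {g : ι → ι} (hg : Function.Involutive g)
    (x y : ι) : reindex g (pairVector x y) = pairVector (g x) (g y) := by
  simp [pairVector, reindex_single hg]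

/-- Hadamard maps the basis vector of `x` to the pair vector only when `x i = false`; otherwise a
minus sign appears. The symmetry of `pairVector` covers the other case. -/
theorem realizes_phaseAlong_flipBit (h𝒢 : IsStandardGateSet 𝒢) (x : Fin M → Bool) (i : Fin M) :
    Realizes 𝒢 Λ (148 * M + 6) (phaseAlong (pairVector x (flipBit i x))) := by
  have key : ∀ x : Fin M → Bool, x i = false →
      Realizes 𝒢 Λ (148 * M + 6) (phaseAlong (pairVector x (flipBit i x))) := by
    intro x hx
    have := (realizes_phaseAlong_single Λ h𝒢 x).conj (realizes_hadamardOp Λ h𝒢 i)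
      (hadamardOp_isSymmetric i) (hadamardOp_hadamardOp i)
    rw [hadamardOp_single i x hx] at this
    exact this
  cases hx : x i
  · exact key x hx
  · have := key (flipBit i x) (by simp [hx])
    rwa [flipBit_flipBit, pairVector_comm] at this

/-- Fix a position `i` where `x` and `y` differ. A controlled-NOT from `i` to another such position
changes that bit in exactly one of the two strings and makes them agree there. At most `M - 1` of
these reduce to strings differing only at `i`. -/
theorem realizes_phaseAlong_pairVector (h𝒢 : IsStandardGateSet 𝒢) {x y : Fin M → Bool}
    (hxy : x ≠ y) : Realizes 𝒢 Λ (150 * M + 6) (phaseAlong (pairVector x y)) := by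
  have key : ∀ s : Finset (Fin M), ∀ (i : Fin M) (x y : Fin M → Bool), i ∉ s → x i ≠ y i →
      (∀ j, j ≠ i → (x j ≠ y j ↔ j ∈ s)) →
      Realizes 𝒢 Λ (148 * M + 6 + 2 * s.card) (phaseAlong (pairVector x y)) := by
    intro s
    induction s using Finset.induction_on with
    | empty =>
      intro i x y _ hi h
      have : y = flipBit i x := by
        ext j
        by_cases hj : j = i
        · subst hj
          rw [flipBit_same]
          revert hi
          cases x j <;> cases y j <;> simp
        · rw [flipBit_of_ne hj]
          have := h j hj
          simp only [Finset.notMem_empty, iff_false, not_not] at this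
          exact this ▸ rfl
      rw [this]
      exact realizes_phaseAlong_flipBit Λ h𝒢 x i
    | insert a s ha ih =>
      intro i x y hi hxy h
      have hai : a ≠ i := by rintro rfl; simp at hi
      have hinv : Function.Involutive (cnotBit i a) := cnotBit_cnotBit hai.symm
      have h1 := ih i (cnotBit i a x) (cnotBit i a y) (by simp at hi; exact hi.2)
        (by rwa [cnotBit_of_ne _ hai.symm, cnotBit_of_ne _ hai.symm]) (fun j hj => by
          by_cases hja : j = a
          · subst hja
            have := (h j hj).2 (by simp)
            simp only [cnotBit_same, ha, iff_false, not_not]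
            revert this hxy
            cases x i <;> cases y i <;> cases x j <;> cases y j <;> simp
          · rw [cnotBit_of_ne _ hja, cnotBit_of_ne _ hja, h j hj]
            simp [hja])
      have h2 := h1.conj (realizes_cnotBit Λ h𝒢 hai.symm) (reindex_isSymmetric hinv)
        (fun v => by ext x; simp [hinv x])
      rw [reindex_pairVector hinv, hinv, hinv] at h2
      refine h2.mono ?_
      rw [Finset.card_insert_of_notMem ha]
      omega
  obtain ⟨i, hi⟩ := Function.ne_iff.1 hxy
  refine (key ((Finset.univ.filter fun j => x j ≠ y j).erase i) i x y (by simp) hi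
    (fun j hj => by simp [hj])).mono ?_
  have := Finset.card_le_univ ((Finset.univ.filter fun j => x j ≠ y j).erase i)
  rw [Fintype.card_fin] at this
  omega

end Standard

end QEnt
end

noncomputable section

namespace QEnt

/-! ## Reduction of Gaussian integer vectors to basis vectors -/

theorem GaussianInt_dvd_iff (g : GaussianInt) :
    (⟨1, 1⟩ : GaussianInt) ∣ g ↔ Even (g.re + g.im) := by
  constructor
  · rintro ⟨⟨a, b⟩, rfl⟩
    exact ⟨a, by simp⟩
  · rintro ⟨a, ha⟩
    refine ⟨⟨a, g.im - a⟩, ?_⟩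
    ext
    · simp only [Zsqrtd.re_mul]; linarith
    · simp only [Zsqrtd.im_mul]; linarith

/-- This turns the normalization `∑ (u x).norm = 2 ^ k` into a statement about the number of entries
not divisible by `1 + i`. -/
theorem even_norm_iff (g : GaussianInt) : Even g.norm ↔ (⟨1, 1⟩ : GaussianInt) ∣ g := by
  rw [GaussianInt_dvd_iff, Zsqrtd.norm_def]
  simp [parity_simps]

theorem toComplex_one_one : GaussianInt.toComplex ⟨1, 1⟩ = 1 + Complex.I := by
  simp [GaussianInt.toComplex_def]

theorem one_add_I_ne_zero : (1 + Complex.I : ℂ) ≠ 0 := by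
  intro h
  simpa using congrArg Complex.re h

theorem normSq_one_add_I : Complex.normSq (1 + Complex.I) = 2 := by
  simp [Complex.normSq_apply]; norm_num

/-- The vector with amplitudes `u x / (1 + i)^k`. -/
def gaussianVector {ι : Type} (k : ℕ) (u : ι → GaussianInt) : EuclideanSpace ℂ ι :=
  WithLp.toLp 2 fun x => (u x : ℂ) / (1 + Complex.I) ^ k

theorem gaussianVector_apply {ι : Type} (k : ℕ) (u : ι → GaussianInt) (x : ι) :
    gaussianVector k u x = (u x : ℂ) / (1 + Complex.I) ^ k := rfl

theorem norm_gaussianVector_sq {ι : Type} [Fintype ι] (k : ℕ) (u : ι → GaussianInt) :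
    ‖gaussianVector k u‖ ^ 2 = ((∑ x, (u x).norm : ℤ) : ℝ) / 2 ^ k := by
  rw [EuclideanSpace.norm_sq_eq]
  push_cast
  rw [Finset.sum_div]
  refine Finset.sum_congr rfl fun x _ => ?_
  rw [gaussianVector_apply, ← Complex.normSq_eq_norm_sq, map_div₀, map_pow, normSq_one_add_I,
    GaussianInt.intCast_real_norm]

theorem sum_norm_of_norm_gaussianVector {ι : Type} [Fintype ι] {k : ℕ} {u : ι → GaussianInt}
    (h : ‖gaussianVector k u‖ = 1) : ∑ x, (u x).norm = 2 ^ k := by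
  have := norm_gaussianVector_sq k u
  rw [h, eq_div_iff (by positivity)] at this
  have h2 : ((∑ x, (u x).norm : ℤ) : ℝ) = ((2 ^ k : ℤ) : ℝ) := by
    push_cast at this ⊢
    linarith
  exact_mod_cast h2

theorem phaseAlong_pairVector_apply {ι : Type} [Fintype ι] [DecidableEq ι] (x y : ι)
    (v : EuclideanSpace ℂ ι) (t : ι) :
    phaseAlong (pairVector x y) v t = v t + (Complex.I - 1) / 2 * (v x + v y) *
      ((if t = x then 1 else 0) + if t = y then 1 else 0) := by
  simp only [phaseAlong, pairVector, PiLp.add_apply, PiLp.smul_apply, PiLp.single_apply,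
    inner_smul_left, inner_add_left, EuclideanSpace.inner_single_left, map_one, one_mul,
    smul_eq_mul, map_inv₀, Complex.conj_ofReal]
  linear_combination (Complex.I - 1) * (v x + v y) *
    ((if t = x then 1 else 0) + if t = y then 1 else 0) * sqrt_two_inv_sq

theorem norm_pairVector {ι : Type} [Fintype ι] [DecidableEq ι] {x y : ι} (h : x ≠ y) :
    ‖pairVector x y‖ = 1 := by
  have : (inner ℂ (pairVector x y) (pairVector x y) : ℂ) = 1 := by
    simp only [pairVector, inner_smul_left, inner_smul_right, inner_add_left,
      EuclideanSpace.inner_single_left, PiLp.add_apply, PiLp.single_apply, h, h.symm, if_true,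
      if_false, map_one, map_inv₀, Complex.conj_ofReal, add_zero, zero_add]
    linear_combination 2 * sqrt_two_inv_sq
  rw [inner_self_eq_norm_sq_to_K] at this
  have h2 : ‖pairVector x y‖ ^ 2 = 1 :=
    Complex.ofReal_eq_one.1 ((Complex.ofReal_pow _ 2).trans this)
  exact (pow_eq_one_iff_of_nonneg (norm_nonneg _) two_ne_zero).1 h2

/-- Modulo 2, an element not divisible by `1 + i` is congruent to `1` or `i`, so `h` or `i h` is
congruent to `i g`. Call it `h'`. Then 2 divides `g + i h'`, and hence also `h' + i g`, which is
congruent to `i (g + i h')`. -/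
theorem exists_half_sum {g h : GaussianInt} (hg : ¬ (⟨1, 1⟩ : GaussianInt) ∣ g)
    (hh : ¬ (⟨1, 1⟩ : GaussianInt) ∣ h) :
    ∃ b : Bool, ∃ s t : GaussianInt,
      2 * s = g + ⟨0, 1⟩ * (if b then ⟨0, 1⟩ * h else h) ∧
      2 * t = (if b then ⟨0, 1⟩ * h else h) + ⟨0, 1⟩ * g := by
  rw [GaussianInt_dvd_iff] at hg hh
  have key : ∀ h : GaussianInt, ¬ Even (h.re + h.im) → Even (g.re - h.im) →
      ∃ s t : GaussianInt, 2 * s = g + ⟨0, 1⟩ * h ∧ 2 * t = h + ⟨0, 1⟩ * g := by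
    intro h hh ⟨p, hp⟩
    have : Even (g.im + h.re) := by
      have e : Even (g.re - h.im) := ⟨p, hp⟩
      simp only [Int.even_add, Int.even_sub] at *
      tauto
    obtain ⟨q, hq⟩ := this
    refine ⟨⟨p, q⟩, ⟨h.re - q, h.im + p⟩, ?_, ?_⟩ <;> ext <;>
      simp [Zsqrtd.re_mul, Zsqrtd.im_mul] <;> linarith
  by_cases hc : Even (g.re - h.im)
  · obtain ⟨s, t, h1, h2⟩ := key h hh hc
    exact ⟨false, s, t, by simpa using h1, by simpa using h2⟩
  · obtain ⟨s, t, h1, h2⟩ := key (⟨0, 1⟩ * h)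
      (by simp only [Zsqrtd.re_mul, Zsqrtd.im_mul, Int.even_add, Int.even_sub] at *; simp; tauto)
      (by simp only [Zsqrtd.im_mul, Int.even_add, Int.even_sub] at *; simp; tauto)
    exact ⟨true, s, t, by simpa using h1, by simpa using h2⟩

/-- Operators that preserve the inner product and are realized by at most `c` gates. -/
def RealizesIsometry {M W : ℕ} (𝒢 : Set Gate) (Λ : Layout M W) (c : ℕ)
    (U : Qubits M → Qubits M) : Prop :=
  Realizes 𝒢 Λ c U ∧ ∀ v w, inner ℂ (U v) (U w) = (inner ℂ v w : ℂ)

variable {M W : ℕ} {𝒢 : Set Gate} {Λ : Layout M W}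

namespace RealizesIsometry

variable {U V : Qubits M → Qubits M} {c c' : ℕ}

theorem id : RealizesIsometry 𝒢 Λ 0 fun v => v := ⟨.id, fun _ _ => rfl⟩

theorem comp (hU : RealizesIsometry 𝒢 Λ c U) (hV : RealizesIsometry 𝒢 Λ c' V) :
    RealizesIsometry 𝒢 Λ (c + c') fun v => V (U v) :=
  ⟨hU.1.comp hV.1, fun v w => (hV.2 _ _).trans (hU.2 v w)⟩

theorem mono (hU : RealizesIsometry 𝒢 Λ c U) (h : c ≤ c') : RealizesIsometry 𝒢 Λ c' U :=
  ⟨hU.1.mono h, hU.2⟩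

theorem norm_eq (hU : RealizesIsometry 𝒢 Λ c U) (v : Qubits M) : ‖U v‖ = ‖v‖ := by
  rw [@norm_eq_sqrt_re_inner ℂ, hU.2, ← @norm_eq_sqrt_re_inner ℂ]

end RealizesIsometry

theorem realizesIsometry_phase_bool (h𝒢 : IsStandardGateSet 𝒢) (y : Fin M → Bool) (b : Bool) :
    ∃ U, RealizesIsometry 𝒢 Λ (148 * M + 4) U ∧
      ∀ v x, U v x = (if x = y ∧ b then Complex.I else 1) * v x := by
  cases b
  · exact ⟨_, RealizesIsometry.id.mono (by omega), by simp⟩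
  · exact ⟨_, ⟨realizes_phaseAlong_single Λ h𝒢 y, inner_phaseAlong (by simp)⟩,
      fun v x => by simpa using phaseAlong_single_apply y v x⟩

/-- A pair of entries that are not divisible by `1 + i` is made divisible. -/
theorem exists_pair_reduction (h𝒢 : IsStandardGateSet 𝒢) (k : ℕ)
    (u : (Fin M → Bool) → GaussianInt) {x y : Fin M → Bool} (hxy : x ≠ y)
    (hx : ¬ (⟨1, 1⟩ : GaussianInt) ∣ u x) (hy : ¬ (⟨1, 1⟩ : GaussianInt) ∣ u y) :
    ∃ U u', RealizesIsometry 𝒢 Λ (298 * M + 10) U ∧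
      U (gaussianVector k u) = gaussianVector k u' ∧ (⟨1, 1⟩ : GaussianInt) ∣ u' x ∧
      ∀ t, (⟨1, 1⟩ : GaussianInt) ∣ u t → (⟨1, 1⟩ : GaussianInt) ∣ u' t := by
  obtain ⟨b, s, t, hs, ht⟩ := exists_half_sum hx hy
  obtain ⟨U, hU, hUv⟩ := realizesIsometry_phase_bool (Λ := Λ) h𝒢 y b
  have hV : RealizesIsometry 𝒢 Λ (150 * M + 6) (phaseAlong (pairVector x y)) :=
    ⟨realizes_phaseAlong_pairVector Λ h𝒢 hxy, inner_phaseAlong (norm_pairVector hxy)⟩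
  -- On the entries `(g, h')` at `x`, `y` the rotation acts as `(1 + i)/2 * (g + i h', h' + i g)`.
  -- The choice of `b` makes both brackets twice a Gaussian integer, so the new numerators are `(1 +
  -- i) s` and `(1 + i) t`.
  refine ⟨_, fun z => if z = x then ⟨1, 1⟩ * s else if z = y then ⟨1, 1⟩ * t else u z,
    (hU.comp hV).mono (by omega), ?_, by simp, fun z hz => ?_⟩
  · have hs' := congrArg GaussianInt.toComplex hs
    have ht' := congrArg GaussianInt.toComplex ht
    have hI : GaussianInt.toComplex ⟨0, 1⟩ = Complex.I := by simp [GaussianInt.toComplex_def]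
    simp only [map_mul, map_add, apply_ite GaussianInt.toComplex, hI, map_ofNat] at hs' ht'
    have ey : U (gaussianVector k u) y =
        (if b then Complex.I * (u y : ℂ) else (u y : ℂ)) / (1 + Complex.I) ^ k := by
      rw [hUv, gaussianVector_apply]
      cases b <;> simp [mul_div_assoc]
    have ex : U (gaussianVector k u) x = (u x : ℂ) / (1 + Complex.I) ^ k := by
      rw [hUv, gaussianVector_apply, if_neg (fun h => hxy h.1), one_mul]
    ext z
    rw [phaseAlong_pairVector_apply, ex, ey, gaussianVector_apply]
    set q : ℂ := if b then Complex.I * (u y : ℂ) else (u y : ℂ)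
    by_cases hzx : z = x
    · subst hzx
      rw [ex]
      simp only [hxy, if_true, if_false, map_mul, toComplex_one_one]
      rw [show (u z : ℂ) = 2 * s - Complex.I * q by rw [hs']; ring]
      linear_combination (-(q / 2) / (1 + Complex.I) ^ k) * Complex.I_sq
    · by_cases hzy : z = y
      · subst hzy
        rw [ey]
        simp only [hzx, if_true, if_false, map_mul, toComplex_one_one]
        rw [show q = 2 * t - Complex.I * (u x : ℂ) by rw [ht']; ring]
        linear_combination (-((u x : ℂ) / 2) / (1 + Complex.I) ^ k) * Complex.I_sq
      · simp [hzx, hzy, hUv, gaussianVector_apply]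
  · simp only
    split_ifs
    exacts [dvd_mul_right _ _, dvd_mul_right _ _, hz]

/-- All entries are made divisible by `1 + i`. -/
theorem exists_round (h𝒢 : IsStandardGateSet 𝒢) (k : ℕ) (s : Finset (Fin M → Bool)) :
    ∀ u : (Fin M → Bool) → GaussianInt, ‖gaussianVector (k + 1) u‖ = 1 →
      (∀ x, ¬ (⟨1, 1⟩ : GaussianInt) ∣ u x → x ∈ s) →
      ∃ U u', RealizesIsometry 𝒢 Λ (s.card * (298 * M + 10)) U ∧
        U (gaussianVector (k + 1) u) = gaussianVector (k + 1) u' ∧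
        ∀ t, (⟨1, 1⟩ : GaussianInt) ∣ u' t := by
  induction s using Finset.induction_on with
  | empty =>
    intro u _ h
    exact ⟨_, u, RealizesIsometry.id.mono (by simp), rfl, fun t => by simpa using h t⟩
  | insert a s ha ih =>
    intro u hu h
    rw [Finset.card_insert_of_notMem ha]
    by_cases hua : (⟨1, 1⟩ : GaussianInt) ∣ u a
    · obtain ⟨U, u', h1, h2, h3⟩ := ih u hu fun x hx =>
        (Finset.mem_insert.1 (h x hx)).resolve_left (by rintro rfl; exact hx hua)
      exact ⟨U, u', h1.mono (Nat.mul_le_mul_right _ (by omega)), h2, h3⟩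
    -- If `a` were the only entry not divisible by `1 + i`, the sum of norms would be odd, but it is
    -- `2 ^ (k + 1)`.
    · obtain ⟨y, hay, hy⟩ : ∃ y, a ≠ y ∧ ¬ (⟨1, 1⟩ : GaussianInt) ∣ u y := by
        by_contra! hc
        have hsum := sum_norm_of_norm_gaussianVector hu
        rw [← Finset.add_sum_erase _ _ (Finset.mem_univ a)] at hsum
        apply hua
        have h2 : Even ((u a).norm + ∑ x ∈ Finset.univ.erase a, (u x).norm) :=
          hsum ▸ even_two.pow_of_ne_zero (by omega)
        exact (even_norm_iff _).1 ((Int.even_add.1 h2).2 (Finset.even_sum _ fun x hx =>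
          (even_norm_iff _).2 (hc x (Finset.ne_of_mem_erase hx).symm)))
      obtain ⟨U, u₁, h1, h2, h3, h4⟩ := exists_pair_reduction (Λ := Λ) h𝒢 (k + 1) u hay hua hy
      obtain ⟨V, u₂, g1, g2, g3⟩ := ih u₁ (by rw [← h2, h1.norm_eq, hu]) fun x hx =>
        (Finset.mem_insert.1 (h x fun h => hx (h4 x h))).resolve_left (by rintro rfl; exact hx h3)
      exact ⟨_, u₂, (h1.comp g1).mono (le_of_eq (by ring)), by rw [h2, g2], g3⟩

/-- A unit vector with amplitudes in `ℤ[i] / (1 + i)^k` is mapped to a basis vector. -/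
theorem exists_reduction (h𝒢 : IsStandardGateSet 𝒢) (k : ℕ) :
    ∀ u : (Fin M → Bool) → GaussianInt, ‖gaussianVector k u‖ = 1 →
      ∃ U z c, RealizesIsometry 𝒢 Λ (k * (2 ^ M * (298 * M + 10))) U ∧
        U (gaussianVector k u) = EuclideanSpace.single z c := by
  induction k with
  | zero =>
    intro u hu
    have hsum := sum_norm_of_norm_gaussianVector hu
    rw [pow_zero] at hsum
    -- Nonnegative integer norms with sum 1: exactly one entry is nonzero.
    obtain ⟨z, hz⟩ : ∃ z, u z ≠ 0 := by
      by_contra! h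
      simp [h] at hsum
    refine ⟨_, z, (u z : ℂ), RealizesIsometry.id.mono (by simp), ?_⟩
    ext x
    rw [PiLp.single_apply, gaussianVector_apply, pow_zero, div_one]
    split_ifs with hxz
    · rw [hxz]
    · rw [← Finset.add_sum_erase _ _ (Finset.mem_univ z),
        ← Finset.add_sum_erase _ _ (Finset.mem_erase.2 ⟨hxz, Finset.mem_univ x⟩)] at hsum
      have h1 := GaussianInt.norm_pos.2 hz
      have h2 := GaussianInt.norm_nonneg (u x)
      have h3 : 0 ≤ ∑ t ∈ (Finset.univ.erase z).erase x, (u t).norm :=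
        Finset.sum_nonneg fun t _ => GaussianInt.norm_nonneg _
      have h4 : u x = 0 := by
        by_contra h
        have := GaussianInt.norm_pos.2 h
        omega
      simp [h4]
  | succ k ih =>
    intro u hu
    obtain ⟨U, u₁, h1, h2, h3⟩ := exists_round (Λ := Λ) h𝒢 k Finset.univ u hu (by simp)
    choose u₂ hu₂ using h3
    have e : gaussianVector (k + 1) u₁ = gaussianVector k u₂ := by
      ext x
      rw [gaussianVector_apply, gaussianVector_apply, hu₂, map_mul, toComplex_one_one, pow_succ']
      exact mul_div_mul_left _ _ one_add_I_ne_zero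
    obtain ⟨V, z, c, g1, g2⟩ := ih u₂ (by rw [← e, ← h2, h1.norm_eq, hu])
    refine ⟨_, z, c, (h1.comp g1).mono (le_of_eq ?_), by rw [h2, e, g2]⟩
    simp only [Finset.card_univ, Fintype.card_fun, Fintype.card_bool, Fintype.card_fin]
    ring

end QEnt
end

noncomputable section

namespace QEnt

variable {M W : ℕ} {𝒢 : Set Gate} {Λ : Layout M W}

/-! ## Measuring the overlap with a Gaussian integer vector -/

/-- If the last work wire receives the conjunction of the data bits, the probability of measuring 1
there is the weight of the string of ones. -/
theorem sum_flag_encode (π : Equiv.Perm (Fin W → Bool))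
    (hπ : ∀ x, Λ.Clean x → (π x (Λ.work (Fin.last M)) = true ↔ x ∘ Λ.data = fun _ => true))
    {r : Fin W → Bool} (hr : Λ.Clean r) (v : Qubits M) :
    (∑ x : Fin W → Bool, if x (Λ.work (Fin.last M)) then
      ‖reindex π.symm (Λ.encode r v) x‖ ^ 2 else 0) = ‖v fun _ => true‖ ^ 2 := by
  classical
  rw [← Equiv.sum_comp π]
  simp only [reindex_apply, Equiv.symm_apply_apply]
  -- `x₀` is the only string in the support of the encoding that raises the flag.
  set x₀ : Fin W → Bool := fun i => if i ∈ Set.range Λ.data then true else r i with hx₀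
  have key : ∀ x, (if π x (Λ.work (Fin.last M)) then ‖Λ.encode r v x‖ ^ 2 else 0) =
      if x = x₀ then ‖v fun _ => true‖ ^ 2 else 0 := by
    intro x
    by_cases h : ∀ i, i ∉ Set.range Λ.data → x i = r i
    · have hx : Λ.Clean x := fun j => (h _ (Λ.work_notMem_range j)).trans (hr j)
      rw [Λ.encode_apply_of _ h]
      by_cases ht : x ∘ Λ.data = fun _ => true
      · rw [if_pos ((hπ x hx).2 ht), if_pos, ht]
        ext i
        by_cases hi : i ∈ Set.range Λ.data
        · obtain ⟨j, rfl⟩ := hi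
          simpa [hx₀] using congrFun ht j
        · simp only [hx₀, if_neg hi, h i hi]
      · rw [if_neg (fun h' => ht ((hπ x hx).1 h')), if_neg]
        rintro rfl
        exact ht (by ext i; simp [hx₀])
    · rw [Λ.encode_apply_of_not _ h, if_neg (c := x = x₀)]
      · simp
      · rintro rfl
        exact h fun i hi => by simp only [hx₀, if_neg hi]
  simp only [key, Finset.sum_ite_eq', Finset.mem_univ, if_true]

/-- A gate sequence after which the last work wire shows 1 with the probability that the data are in
a given state with amplitudes in `ℤ[i] / (1 + i)^k`. -/
theorem exists_overlap_measurement (h𝒢 : IsStandardGateSet 𝒢) (Λ : Layout M W) (k : ℕ)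
    (u : (Fin M → Bool) → GaussianInt) (hu : ‖gaussianVector k u‖ = 1) :
    ∃ L : List (PlacedGate W), (∀ o ∈ L, o.1 ∈ 𝒢) ∧
      L.length ≤ k * (2 ^ M * (298 * M + 10)) + M + (73 * M + 1) ∧
      ∀ r, Λ.Clean r → ∀ w : Qubits M,
        (∑ x : Fin W → Bool, if x (Λ.work (Fin.last M)) then
          ‖runOps L (Λ.encode r w) x‖ ^ 2 else 0) = ‖(inner ℂ (gaussianVector k u) w : ℂ)‖ ^ 2 := by
  obtain ⟨U, z, c, hU, hz⟩ := exists_reduction (Λ := Λ) h𝒢 k u hu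
  obtain ⟨g, hg, hgz, hr⟩ := exists_reindex_single_true Λ h𝒢 z
  obtain ⟨π, -, ⟨L', g1, g2, g3⟩, hπ⟩ := exists_flag Λ h𝒢
  obtain ⟨L, h1, h2, h3⟩ := hU.1.comp hr
  have hc : ‖c‖ = 1 := by
    have := hU.norm_eq (gaussianVector k u)
    rwa [hz, hu, PiLp.norm_single] at this
  refine ⟨L ++ L', fun o ho => (List.mem_append.1 ho).elim (h1 o) (g1 o),
    by simpa using add_le_add h2 g2, fun r hr w => ?_⟩
  simp only [runOps_append, g3, h3 r hr]
  -- The amplitude of the all-ones string is that of `U w` at `z`. Up to the unit factor `c` it is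
  -- `⟨U u, U w⟩ = ⟨u, w⟩`, by preservation of inner products.
  rw [sum_flag_encode π hπ hr, reindex_apply, ← hgz, hg, ← hU.2, hz,
    EuclideanSpace.inner_single_left, norm_mul, RCLike.norm_conj, hc, one_mul]

/-! ## Gaussian integer approximation -/

/-- The state `|0⟩|φ⟩`. -/
def zeroCons {n : ℕ} (φ : Qubits n) : Qubits (n + 1) :=
  WithLp.toLp 2 fun x => if x 0 then 0 else φ (Fin.tail x)

theorem zeroCons_apply {n : ℕ} (φ : Qubits n) (x : Fin (n + 1) → Bool) :
    zeroCons φ x = if x 0 then 0 else φ (Fin.tail x) := rfl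

theorem sum_cons {n : ℕ} {α : Type} [AddCommMonoid α] (F : (Fin (n + 1) → Bool) → α) :
    ∑ x, F x = ∑ y : Fin n → Bool, F (Fin.cons true y) + ∑ y, F (Fin.cons false y) := by
  rw [← Equiv.sum_comp (Fin.consEquiv fun _ => Bool), Fintype.sum_prod_type, Fintype.sum_bool]
  rfl

/-- Rounding is towards zero, so that the norm does not grow and the deficit filled by
`exists_completion` is nonnegative. -/
theorem exists_int_truncation (t : ℝ) : ∃ a : ℤ, |(a : ℝ)| ≤ |t| ∧ |t - a| ≤ 1 := by
  rcases le_total 0 t with h | h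
  · have h1 := Int.floor_le t
    have h2 := Int.lt_floor_add_one t
    have h3 : (0 : ℝ) ≤ ⌊t⌋ := by exact_mod_cast Int.floor_nonneg.2 h
    refine ⟨⌊t⌋, by rwa [abs_of_nonneg h3, abs_of_nonneg h], abs_le.2 ⟨?_, ?_⟩⟩ <;> linarith
  · have h1 := Int.le_ceil t
    have h2 := Int.ceil_lt_add_one t
    have h3 : (⌈t⌉ : ℝ) ≤ 0 := by exact_mod_cast Int.ceil_le.2 (by simpa using h)
    refine ⟨⌈t⌉, by rw [abs_of_nonpos h3, abs_of_nonpos h]; linarith, abs_le.2 ⟨?_, ?_⟩⟩ <;> linarith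

theorem exists_gaussianInt_truncation (ζ : ℂ) :
    ∃ g : GaussianInt, ‖(g : ℂ)‖ ^ 2 ≤ ‖ζ‖ ^ 2 ∧ ‖ζ - g‖ ^ 2 ≤ 4 := by
  obtain ⟨a, ha, ha'⟩ := exists_int_truncation ζ.re
  obtain ⟨b, hb, hb'⟩ := exists_int_truncation ζ.im
  refine ⟨⟨a, b⟩, ?_, ?_⟩
  · have h1 := sq_le_sq.2 ha
    have h2 := sq_le_sq.2 hb
    rw [← Complex.normSq_eq_norm_sq, ← Complex.normSq_eq_norm_sq, Complex.normSq_apply,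
      Complex.normSq_apply]
    simp only [GaussianInt.re_toComplex, GaussianInt.im_toComplex]
    linarith
  · have h1 := (sq_le_one_iff_abs_le_one _).2 ha'
    have h2 := (sq_le_one_iff_abs_le_one _).2 hb'
    rw [← Complex.normSq_eq_norm_sq, Complex.normSq_apply]
    simp only [Complex.sub_re, Complex.sub_im, GaussianInt.re_toComplex, GaussianInt.im_toComplex]
    linarith

/-- A family of Gaussian integers with small norm is completed to one of norm `N` with one further
bit, by Lagrange's four-square theorem. -/
theorem exists_completion {n : ℕ} (hn : 1 ≤ n) (a : (Fin n → Bool) → GaussianInt) (N : ℕ)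
    (h : ∑ y, (a y).norm ≤ N) :
    ∃ u : (Fin (n + 1) → Bool) → GaussianInt, (∀ y, u (Fin.cons false y) = a y) ∧
      ∑ x, (u x).norm = N := by
  obtain ⟨m, hm⟩ := Int.eq_ofNat_of_zero_le (sub_nonneg.2 h)
  obtain ⟨p, q, s, t, hpq⟩ := Nat.sum_four_squares m
  have hne : (fun _ : Fin n => true) ≠ fun _ => false := fun h => by
    simpa using congrFun h ⟨0, hn⟩
  -- The two Gaussian integers need two distinct places; `1 ≤ n` provides the all-ones and all-zeros
  -- strings.
  let e : (Fin n → Bool) → GaussianInt := fun y =>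
    if y = fun _ => true then ⟨p, q⟩ else if y = fun _ => false then ⟨s, t⟩ else 0
  have he : ∑ y, (e y).norm = m := by
    have : ∀ y, (e y).norm = (if y = fun _ => true then (p ^ 2 + q ^ 2 : ℤ) else 0) +
        if y = fun _ => false then (s ^ 2 + t ^ 2 : ℤ) else 0 := by
      intro y
      simp only [e]
      by_cases h1 : y = fun _ => true
      · subst h1
        simp only [if_true, if_neg hne, Zsqrtd.norm_def]
        ring
      · by_cases h2 : y = fun _ => false
        · simp only [h2, if_true, if_false, hne.symm, Zsqrtd.norm_def]
          ring
        · simp [h1, h2]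
    simp only [this, Finset.sum_add_distrib, Finset.sum_ite_eq', Finset.mem_univ, if_true]
    rw [← hpq]
    push_cast
    ring
  refine ⟨fun x => if x 0 then e (Fin.tail x) else a (Fin.tail x), fun y => by simp, ?_⟩
  rw [sum_cons]
  simp only [Fin.cons_zero, Fin.tail_cons, if_true, Bool.false_eq_true, if_false, he]
  linarith

theorem one_add_I_pow (j : ℕ) : (1 + Complex.I) ^ (2 * j) = 2 ^ j * Complex.I ^ j := by
  rw [pow_mul, ← mul_pow]
  congr 1
  linear_combination Complex.I_sq

/-- The exponent is even because `(1 + i)^(2j) = 2^j i^j`: up to a global phase, which does not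
affect the modulus of the overlap, the denominator is `2^j`. -/
theorem exists_gaussianVector_approx {n : ℕ} (hn : 1 ≤ n) (j : ℕ) (ξ : Qustring n) :
    ∃ u : (Fin (n + 1) → Bool) → GaussianInt, ‖gaussianVector (2 * j) u‖ = 1 ∧
      ∀ φ : Qustring n, |‖(inner ℂ (gaussianVector (2 * j) u) (zeroCons φ.1) : ℂ)‖ -
        ‖(inner ℂ ξ.1 φ.1 : ℂ)‖| ≤ 2 * 2 ^ n / 2 ^ j := by
  choose a ha ha' using fun y => exists_gaussianInt_truncation (2 ^ j * ξ.1 y)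
  have hξ : ∑ y, ‖ξ.1 y‖ ^ 2 = 1 := by
    rw [← EuclideanSpace.norm_sq_eq, ξ.2, one_pow]
  have hsum : ∑ y, (a y).norm ≤ ((4 ^ j : ℕ) : ℤ) := by
    have h1 : ∑ y, ‖(a y : ℂ)‖ ^ 2 ≤ ∑ y, ‖2 ^ j * ξ.1 y‖ ^ 2 := Finset.sum_le_sum fun y _ => ha y
    simp only [norm_mul, mul_pow, ← Finset.mul_sum, hξ] at h1
    simp only [← Complex.normSq_eq_norm_sq (GaussianInt.toComplex _),
      ← GaussianInt.intCast_real_norm] at h1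
    have h2 : ‖(2 ^ j : ℂ)‖ ^ 2 * 1 = (4 ^ j : ℝ) := by
      rw [norm_pow, Complex.norm_ofNat, mul_one, ← pow_mul, mul_comm, pow_mul]
      norm_num
    rw [h2] at h1
    exact_mod_cast h1
  obtain ⟨u, hu, hus⟩ := exists_completion hn a _ hsum
  refine ⟨u, ?_, fun φ => ?_⟩
  · rw [← pow_eq_one_iff_of_nonneg (norm_nonneg _) two_ne_zero, norm_gaussianVector_sq, hus, pow_mul]
    norm_num
  -- The completing entries sit where the new bit is 1, and `zeroCons` vanishes there.
  · have e1 : (inner ℂ (gaussianVector (2 * j) u) (zeroCons φ.1) : ℂ) =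
        inner ℂ (gaussianVector (2 * j) a) φ.1 := by
      simp only [PiLp.inner_apply]
      rw [sum_cons]
      simp [zeroCons_apply, gaussianVector_apply, hu]
    have e2 : ‖(inner ℂ (gaussianVector (2 * j) a) φ.1 : ℂ)‖ =
        ‖(inner ℂ (Complex.I ^ j • gaussianVector (2 * j) a) φ.1 : ℂ)‖ := by
      rw [inner_smul_left, norm_mul, RCLike.norm_conj, norm_pow, Complex.norm_I, one_pow, one_mul]
    have e3 : ‖Complex.I ^ j • gaussianVector (2 * j) a - ξ.1‖ ≤ 2 * 2 ^ n / 2 ^ j := by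
      refine le_of_sq_le_sq ?_ (by positivity)
      rw [EuclideanSpace.norm_sq_eq]
      have hterm : ∀ y, ‖(Complex.I ^ j • gaussianVector (2 * j) a - ξ.1) y‖ ^ 2 ≤ 4 / 4 ^ j := by
        intro y
        have : (Complex.I ^ j • gaussianVector (2 * j) a - ξ.1) y =
            -((2 ^ j * ξ.1 y - a y) / 2 ^ j) := by
          simp only [PiLp.sub_apply, PiLp.smul_apply, smul_eq_mul, gaussianVector_apply,
            one_add_I_pow]
          have : Complex.I ^ j ≠ 0 := pow_ne_zero _ Complex.I_ne_zero
          field_simp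
          ring
        rw [this, norm_neg, norm_div, div_pow, norm_pow, Complex.norm_ofNat, ← pow_mul,
          mul_comm j, pow_mul]
        norm_num
        gcongr
        exact ha' y
      calc _ ≤ ∑ _y : Fin n → Bool, (4 / 4 ^ j : ℝ) := Finset.sum_le_sum fun y _ => hterm y
        _ = 4 * 2 ^ n / 4 ^ j := by
          simp only [Finset.sum_const, Finset.card_univ, Fintype.card_fun, Fintype.card_bool,
            Fintype.card_fin, nsmul_eq_mul]
          push_cast
          ring
        -- A wasteful factor `2 ^ n` makes the bound a perfect square; it only costs additional bits
        -- of precision.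
        _ ≤ 4 * (2 ^ n * 2 ^ n) / 4 ^ j := by
          gcongr
          exact le_mul_of_one_le_left (by positivity) (one_le_pow₀ (by norm_num))
        _ = (2 * 2 ^ n / 2 ^ j) ^ 2 := by
          rw [div_pow, mul_pow, ← pow_mul 2 j, mul_comm j, pow_mul]
          norm_num
          ring
    rw [e1, e2]
    refine (abs_norm_sub_norm_le _ _).trans ?_
    rw [← inner_sub_left]
    refine (norm_inner_le_norm _ _).trans ?_
    rwa [φ.2, mul_one]

end QEnt
end

noncomputable section

namespace QEnt

/-! ## Trace distance of pure states -/

theorem ketbra_isHermitian {n : ℕ} (φ : Qubits n) : (ketbra φ).IsHermitian := by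
  ext x y
  simp [ketbra, Matrix.vecMulVec_apply, mul_comm]

theorem trace_ketbra_mul {n : ℕ} (φ ψ : Qubits n) :
    (ketbra φ * ketbra ψ).trace = ((‖(inner ℂ φ ψ : ℂ)‖ ^ 2 : ℝ) : ℂ) := by
  have h : star φ.ofLp ⬝ᵥ ψ.ofLp = inner ℂ φ ψ := dotProduct_comm _ _
  have h' : φ.ofLp ⬝ᵥ star ψ.ofLp = star (inner ℂ φ ψ : ℂ) := (inner_conj_symm ψ φ).symm
  rw [ketbra, ketbra, Matrix.vecMulVec_mul_vecMulVec, Matrix.trace_vecMulVec, h, dotProduct_smul,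
    h', smul_eq_mul, ← Complex.normSq_eq_norm_sq, ← Complex.mul_conj]
  rfl

theorem rank_sub_ketbra_le {n : ℕ} (φ ψ : Qubits n) : (ketbra φ - ketbra ψ).rank ≤ 2 := by
  have h : ketbra φ - ketbra ψ = (Matrix.of fun x (i : Fin 2) => ![φ x, ψ x] i) *
      (Matrix.of fun (i : Fin 2) y => ![star (φ y), -star (ψ y)] i) := by
    ext x y
    simp [ketbra, Matrix.vecMulVec_apply, Matrix.mul_apply, Fin.sum_univ_two, sub_eq_add_neg]
  rw [h]
  exact (Matrix.rank_mul_le_left _ _).trans (Matrix.rank_le_card_width _)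

-- The eigenvalues of `Xᴴ X` sum to `Tr X² = 2 (1 - |⟨φ, ψ⟩|²)`, and at most two of them are nonzero
-- since `X` has rank at most 2. Cauchy–Schwarz over these two bounds the sum of their square roots.
open scoped ComplexOrder in
theorem trNorm_sub_ketbra_le {n : ℕ} (φ ψ : Qustring n) :
    trNorm (ketbra φ.1 - ketbra ψ.1) ≤ √(1 - ‖(inner ℂ φ.1 ψ.1 : ℂ)‖ ^ 2) := by
  set X := ketbra φ.1 - ketbra ψ.1 with hX
  have hH := Matrix.isHermitian_conjTranspose_mul_self X
  have hXH : X.conjTranspose = X := ((ketbra_isHermitian φ.1).sub (ketbra_isHermitian ψ.1)).eq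
  have h0 : ∀ i, 0 ≤ hH.eigenvalues i :=
    (Matrix.posSemidef_conjTranspose_mul_self X).eigenvalues_nonneg
  have hrank : (X.conjTranspose * X).rank ≤ 2 := by
    rw [Matrix.rank_conjTranspose_mul_self]
    exact rank_sub_ketbra_le _ _
  have hsum : ∑ i, hH.eigenvalues i = 2 * (1 - ‖(inner ℂ φ.1 ψ.1 : ℂ)‖ ^ 2) := by
    have ht := hH.trace_eq_sum_eigenvalues
    have hself : ∀ χ : Qustring n, ‖(inner ℂ χ.1 χ.1 : ℂ)‖ ^ 2 = 1 := by
      intro χ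
      rw [inner_self_eq_norm_sq_to_K, χ.2]; norm_num
    have e : (X.conjTranspose * X).trace =
        ((2 * (1 - ‖(inner ℂ φ.1 ψ.1 : ℂ)‖ ^ 2) : ℝ) : ℂ) := by
      rw [hXH, hX, sub_mul, mul_sub, mul_sub, Matrix.trace_sub, Matrix.trace_sub, Matrix.trace_sub,
        trace_ketbra_mul, trace_ketbra_mul, trace_ketbra_mul, trace_ketbra_mul, hself, hself,
        norm_inner_symm ψ.1 φ.1]
      push_cast
      ring
    rw [e] at ht
    apply Complex.ofReal_injective
    rw [ht]
    simp
  rw [hH.rank_eq_card_non_zero_eigs, Fintype.card_subtype] at hrank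
  set s := Finset.univ.filter fun i => hH.eigenvalues i ≠ 0
  have hs : ∑ i, √(hH.eigenvalues i) = ∑ i ∈ s, √(hH.eigenvalues i) := by
    symm
    refine Finset.sum_subset (Finset.subset_univ s) fun i _ hi => ?_
    have : hH.eigenvalues i = 0 := by simpa [s] using hi
    rw [this, Real.sqrt_zero]
  have hcs : (∑ i ∈ s, √(hH.eigenvalues i)) ^ 2 ≤ 4 * (1 - ‖(inner ℂ φ.1 ψ.1 : ℂ)‖ ^ 2) := by
    refine sq_sum_le_card_mul_sum_sq.trans ?_
    have h1 : ∑ i ∈ s, √(hH.eigenvalues i) ^ 2 ≤ ∑ i, hH.eigenvalues i := by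
      simp only [Real.sq_sqrt (h0 _)]
      exact Finset.sum_le_sum_of_subset_of_nonneg (Finset.subset_univ s) fun i _ _ => h0 i
    have h2 : (s.card : ℝ) ≤ 2 := by exact_mod_cast hrank
    calc _ ≤ 2 * ∑ i, hH.eigenvalues i := by
          refine mul_le_mul h2 h1 (Finset.sum_nonneg fun i _ => sq_nonneg _) (by norm_num)
      _ = _ := by rw [hsum]; ring
  refine Real.le_sqrt_of_sq_le ?_
  change (1 / 2 * ∑ i, √(hH.eigenvalues i)) ^ 2 ≤ _
  rw [hs]
  linarith [mul_pow (1 / 2 : ℝ) (∑ i ∈ s, √(hH.eigenvalues i)) 2]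

/-- An overlap bound for ensembles that are far from separable states. -/
theorem overlap_sq_lt_of_lt_sdis {n k : ℕ} {ξ φ : Qustring n} {δ : ℝ} (hδ : 0 ≤ δ)
    (h : ENNReal.ofReal δ < sdis k ξ) (hφ : IsSeparable k φ) :
    ‖(inner ℂ ξ.1 φ.1 : ℂ)‖ ^ 2 < 1 - δ ^ 2 := by
  have h1 : ENNReal.ofReal δ < ENNReal.ofReal (trNorm (ketbra ξ.1 - ketbra φ.1)) :=
    h.trans_le (iInf₂_le φ hφ)
  have h2 := (Real.lt_sqrt hδ).1 (((ENNReal.ofReal_lt_ofReal_iff_of_nonneg hδ).1 h1).trans_le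
    (trNorm_sub_ketbra_le ξ φ))
  linarith

end QEnt
end

noncomputable section

namespace QEnt

/-! ## The distinguisher -/

/-- The wires of a distinguisher: the data are the first ancilla and the qubits of the given
qustring, the work wires are the other ancillas. -/
def distinguisherLayout (n k : ℕ) : Layout (n + 1) (inputLength n k + (n + 3)) where
  data := ⟨Fin.cons (Fin.natAdd _ 0) fun i => Fin.castAdd _ (Fin.natAdd _ i), by
    rw [Fin.cons_injective_iff]
    refine ⟨?_, fun i j h => ?_⟩
    · rintro ⟨i, hi⟩
      have := congrArg Fin.val hi
      simp at this
      omega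
    · simpa [Fin.ext_iff] using h⟩
  work := ⟨fun t => Fin.natAdd _ (Fin.succ t), fun i j h => by simpa [Fin.ext_iff] using h⟩
  disjoint i j h := by
    have := congrArg Fin.val h
    cases i using Fin.cases with
    | zero =>
      change labelLength n k + n + 0 = labelLength n k + n + ((j : ℕ) + 1) at this
      omega
    | succ i =>
      change labelLength n k + (i : ℕ) = labelLength n k + n + ((j : ℕ) + 1) at this
      omega

/-- The initial contents of the wires, apart from the data. -/
def distinguisherLabel {n : ℕ} (k : ℕ) (σ : Equiv.Perm (Fin n)) (m : Composition n) :
    Fin (inputLength n k + (n + 3)) → Bool :=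
  Fin.append (Fin.append (label k σ m) fun _ => false) fun _ => false

theorem distinguisherLabel_clean {n : ℕ} (k : ℕ) (σ : Equiv.Perm (Fin n)) (m : Composition n) :
    (distinguisherLayout n k).Clean (distinguisherLabel k σ m) :=
  fun _ => Fin.append_right _ _ _

/-- The right side is the initial state of a circuit with `n + 3` ancillas. The first ancilla serves
as the extra data qubit of `zeroCons`, the other `n + 2` as clean work wires, and the label stays on
wires that are neither. -/
theorem encode_zeroCons_apply {n : ℕ} (k : ℕ) (σ : Equiv.Perm (Fin n)) (m : Composition n)
    (φ : Qubits n) (x : Fin (inputLength n k + (n + 3)) → Bool) :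
    (distinguisherLayout n k).encode (distinguisherLabel k σ m) (zeroCons φ) x =
      if x ∘ Fin.natAdd (inputLength n k) = fun _ => false then
        labelled k σ m φ (x ∘ Fin.castAdd (n + 3)) else 0 := by
  have h0 : (x ∘ (distinguisherLayout n k).data) 0 = x (Fin.natAdd _ 0) := rfl
  have h1 : Fin.tail (x ∘ (distinguisherLayout n k).data) =
      (x ∘ Fin.castAdd (n + 3)) ∘ Fin.natAdd (labelLength n k) := rfl
  have hl : labelled k σ m φ (x ∘ Fin.castAdd (n + 3)) =
      if (x ∘ Fin.castAdd (n + 3)) ∘ Fin.castAdd n = label k σ m then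
        φ ((x ∘ Fin.castAdd (n + 3)) ∘ Fin.natAdd (labelLength n k)) else 0 := rfl
  have hblock : (∀ i, i ∉ Set.range (distinguisherLayout n k).data →
      x i = distinguisherLabel k σ m i) ↔
      (x ∘ Fin.castAdd (n + 3)) ∘ Fin.castAdd n = label k σ m ∧
        ∀ t : Fin (n + 2), x (Fin.natAdd _ t.succ) = false := by
    constructor
    · intro h
      refine ⟨funext fun i => ?_, fun t => ?_⟩
      · refine (h _ ?_).trans ?_
        · rintro ⟨j, hj⟩
          have := congrArg Fin.val hj
          cases j using Fin.cases with
          | zero =>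
            change labelLength n k + n + 0 = (i : ℕ) at this
            omega
          | succ j =>
            change labelLength n k + (j : ℕ) = (i : ℕ) at this
            omega
        · simp [distinguisherLabel]
      · exact (h _ ((distinguisherLayout n k).work_notMem_range t)).trans
          (distinguisherLabel_clean k σ m t)
    · rintro ⟨h, h'⟩ i hi
      cases i using Fin.addCases with
      | left i =>
        cases i using Fin.addCases with
        | left i => simpa [distinguisherLabel] using congrFun h i
        | right i => exact absurd ⟨i.succ, rfl⟩ hi
      | right i =>
        cases i using Fin.cases with
        | zero => exact absurd ⟨0, rfl⟩ hi
        | succ i => exact (h' i).trans (distinguisherLabel_clean k σ m i).symm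
  have hanc : (x ∘ Fin.natAdd (inputLength n k) = fun _ => false) ↔
      x (Fin.natAdd _ 0) = false ∧ ∀ t : Fin (n + 2), x (Fin.natAdd _ t.succ) = false := by
    rw [funext_iff, Fin.forall_fin_succ]
    rfl
  by_cases hb : ∀ i, i ∉ Set.range (distinguisherLayout n k).data →
      x i = distinguisherLabel k σ m i
  · rw [Layout.encode_apply_of _ _ hb, zeroCons_apply, h0, h1, hl, if_pos (hblock.1 hb).1]
    simp only [hanc, (hblock.1 hb).2, implies_true, and_true]
    cases x (Fin.natAdd (inputLength n k) 0) <;> simp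
  · rw [Layout.encode_apply_of_not _ _ hb, hl]
    rw [hblock] at hb
    split_ifs with h2 h3
    · exact absurd ⟨h3, (hanc.1 h2).2⟩ hb
    · rfl
    · rfl

/-- A circuit that accepts a labelled qustring with the probability of finding it in a state that is
approximately `ξ`. -/
theorem exists_circuit {𝒢 : Set Gate} (h𝒢 : IsStandardGateSet 𝒢) {n : ℕ} (hn : 1 ≤ n) (k j : ℕ)
    (ξ : Qustring n) :
    ∃ C : Circuit 𝒢 (inputLength n k),
      C.size ≤ 2 * j * (2 ^ (n + 1) * (298 * (n + 1) + 10)) + (n + 1) + (73 * (n + 1) + 1) ∧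
      ∀ φ : Qustring n, ∃ p : ℝ, 0 ≤ p ∧
        |p - ‖(inner ℂ ξ.1 φ.1 : ℂ)‖| ≤ 2 * 2 ^ n / 2 ^ j ∧
        ∀ σ m, C.acceptProb (labelled k σ m φ.1) = p ^ 2 := by
  obtain ⟨u, hu, hφ⟩ := exists_gaussianVector_approx hn j ξ
  obtain ⟨L, h1, h2, h3⟩ := exists_overlap_measurement h𝒢 (distinguisherLayout n k) (2 * j) u hu
  refine ⟨⟨n + 3, L, h1, (distinguisherLayout n k).work (Fin.last (n + 1))⟩, h2, fun φ =>
    ⟨_, norm_nonneg _, hφ φ, fun σ m => ?_⟩⟩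
  rw [← h3 _ (distinguisherLabel_clean k σ m)]
  have : (distinguisherLayout n k).encode (distinguisherLabel k σ m) (zeroCons φ.1) =
      Circuit.init (⟨n + 3, L, h1, (distinguisherLayout n k).work (Fin.last (n + 1))⟩ :
        Circuit 𝒢 (inputLength n k)) (labelled k σ m φ.1) :=
    PiLp.ext fun x => encode_zeroCons_apply k σ m φ.1 x
  rw [this]
  rfl

/-! ### Estimates for the acceptance gap and the circuit size. -/

theorem distinguishing_gap {ε δ c p q τ : ℝ} (hε : ε ∈ Set.Ioc (0 : ℝ) 1)
    (hεδ : ε + √ε < δ) (hc : 0 ≤ c) (hcδ : c ^ 2 < 1 - δ ^ 2) (hτ : τ ≤ ε / 8)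
    (hq0 : 0 ≤ q) (hp : |p - 1| ≤ τ) (hq : |q - c| ≤ τ) :
    ((δ - ε) ^ 2 - ε) / 2 ≤ |p ^ 2 - q ^ 2| := by
  obtain ⟨h0, h1⟩ := hε
  have hs := Real.sqrt_nonneg ε
  have hp1 := (abs_le.1 hp).1
  have hq1 := (abs_le.1 hq).2
  have hc1 : c ≤ 1 := by nlinarith [sq_nonneg δ]
  have hp2 : (1 - ε / 8) ^ 2 ≤ p ^ 2 := pow_le_pow_left₀ (by linarith) (by linarith) 2
  have hq2 : q ^ 2 ≤ (c + ε / 8) ^ 2 := pow_le_pow_left₀ hq0 (by linarith) 2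
  have hd : (δ - ε) ^ 2 ≤ δ ^ 2 := pow_le_pow_left₀ (by linarith) (by linarith) 2
  refine le_trans ?_ (le_abs_self _)
  -- As `c ≤ 1`, the squares differ by at least `1 - c² - ε/2 > δ² - ε/2 ≥ (δ - ε)² - ε/2`, and
  -- halving the square `(δ - ε)²` only decreases this.
  nlinarith

/-- The number of bits of precision of the amplitudes. -/
def precision (n : ℕ) (ε : ℝ) : ℕ := n + ⌈Real.logb 2 (1 / ε)⌉₊ + 4

theorem precision_error {n : ℕ} {ε : ℝ} (hε : 0 < ε) :
    2 * 2 ^ n / 2 ^ precision n ε ≤ ε / 8 := by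
  have h : 1 / ε ≤ 2 ^ ⌈Real.logb 2 (1 / ε)⌉₊ := by
    rw [← Real.rpow_natCast, ← Real.logb_le_iff_le_rpow (by norm_num) (by positivity)]
    exact Nat.le_ceil _
  rw [div_le_iff₀ hε] at h
  rw [precision, pow_add, pow_add, div_le_iff₀ (by positivity)]
  -- The summand 4 in `precision` gives the factor 16 that turns `2 * ε` into `ε / 8`.
  have h2 : (0 : ℝ) < 2 ^ n := by positivity
  nlinarith

theorem size_bound {n : ℕ} (hn : 1 ≤ n) {ε : ℝ} (hε : ε ∈ Set.Ioc (0 : ℝ) 1) :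
    ((2 * precision n ε * (2 ^ (n + 1) * (298 * (n + 1) + 10)) + (n + 1) + (73 * (n + 1) + 1) : ℕ) : ℝ)
      ≤ 15000 * ((n : ℝ) ^ 2 * 2 ^ n *
        (Real.logb 2 ((n : ℝ) ^ 2 * 2 ^ (2 * n) / ε)) ^ 2) := by
  obtain ⟨h0, h1⟩ := hε
  have hn' : (1 : ℝ) ≤ n := by exact_mod_cast hn
  set a := Real.logb 2 (1 / ε) with ha
  set L := Real.logb 2 ((n : ℝ) ^ 2 * 2 ^ (2 * n) / ε) with hL
  have ha0 : 0 ≤ a := Real.logb_nonneg (by norm_num) (by rw [le_div_iff₀ h0]; linarith)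
  have hLa : 2 * n + a ≤ L := by
    have e : (2 * n + a : ℝ) = Real.logb 2 (2 ^ (2 * n) * (1 / ε)) := by
      rw [Real.logb_mul (by positivity) (by positivity), Real.logb_pow,
        Real.logb_self_eq_one (by norm_num)]
      push_cast
      ring
    rw [e]
    refine Real.logb_le_logb_of_le (by norm_num) (by positivity) ?_
    rw [mul_one_div]
    gcongr
    exact le_mul_of_one_le_left (by positivity) (one_le_pow₀ hn')
  have hj : (precision n ε : ℝ) ≤ L + 5 := by
    have := Nat.ceil_lt_add_one ha0
    rw [precision]
    push_cast
    linarith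
  have hL1 : 1 ≤ L := by linarith
  -- Since `L ≥ 1`, the bound `L + 5` is absorbed into `6 * L ^ 2`, the form in the growth
  -- hypothesis.
  have hjL : (precision n ε : ℝ) ≤ 6 * L ^ 2 := by nlinarith
  have hj0 : (0 : ℝ) ≤ precision n ε := Nat.cast_nonneg _
  have hp : (1 : ℝ) ≤ 2 ^ n := one_le_pow₀ (by norm_num)
  have hnn : (n : ℝ) ≤ n ^ 2 := by nlinarith
  push_cast
  calc (2 * (precision n ε : ℝ) * (2 ^ (n + 1) * (298 * (n + 1) + 10)) + (n + 1) + (73 * (n + 1) + 1) : ℝ)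
      ≤ 2 * (6 * L ^ 2) * (2 ^ (n + 1) * (606 * n)) + 149 * n := by
        have : (298 * (n + 1) + 10 : ℝ) ≤ 606 * n := by linarith
        have : (2 * (precision n ε : ℝ) * (2 ^ (n + 1) * (298 * (n + 1) + 10))) ≤
          2 * (6 * L ^ 2) * (2 ^ (n + 1) * (606 * n)) := by gcongr
        linarith
    _ = 14544 * (n * 2 ^ n * L ^ 2) + 149 * (n * 1 * 1) := by ring
    _ ≤ 14544 * (n ^ 2 * 2 ^ n * L ^ 2) + 149 * (n ^ 2 * 2 ^ n * L ^ 2) := by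
        have : (1 : ℝ) ≤ L ^ 2 := one_le_pow₀ hL1
        gcongr
    _ ≤ _ := by
        have : 0 ≤ (n : ℝ) ^ 2 * 2 ^ n * L ^ 2 := by positivity
        linarith

end QEnt

end

/-! ### Assembly of the distinguishing family. -/

theorem mainTheorem5 (𝒢 : Set QEnt.Gate) (h𝒢 : QEnt.IsStandardGateSet 𝒢)
    (ℓ k : ℕ → ℕ) (hk : ∀ n, 2 ≤ k n)
    (ε δ : ℕ → ℝ) (hε : ∀ n, ε n ∈ Set.Ioc (0 : ℝ) 1) (hδ : ∀ n, δ n ∈ Set.Icc (0 : ℝ) 1)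
    (hεδ : ∀ n, ε n + √(ε n) < δ n)
    (hgrowth : (fun n => (ℓ n : ℝ) ^ 2 * 2 ^ (ℓ n) *
        (Real.logb 2 ((ℓ n : ℝ) ^ 2 * 2 ^ (2 * ℓ n) / ε n)) ^ 2)
      =O[Filter.atTop] fun n => (2 : ℝ) ^ (2 * ℓ n))
    (ξ : ∀ n, QEnt.Qustring (ℓ n)) (hξ : QEnt.IsEntanglementEnsemble ℓ ξ)
    (hfar : QEnt.FarFromSeparable k δ ξ) :
    ∃ s : ℕ → ℕ,
      (fun n => (s n : ℝ)) =O[Filter.atTop] (fun n => (2 : ℝ) ^ (2 * ℓ n)) ∧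
      QEnt.Distinguishable 𝒢 k (fun n => ((δ n - ε n) ^ 2 - ε n) / 2) s ξ := by
  have hD : ∀ n, ∃ C : QEnt.Circuit 𝒢 (QEnt.inputLength (ℓ n) (k n)), 1 ≤ ℓ n →
      (C.size : ℝ) ≤ 15000 * ((ℓ n : ℝ) ^ 2 * 2 ^ (ℓ n) *
        (Real.logb 2 ((ℓ n : ℝ) ^ 2 * 2 ^ (2 * ℓ n) / ε n)) ^ 2) ∧
      ∀ φ : QEnt.Qustring (ℓ n), ∃ p : ℝ, 0 ≤ p ∧
        |p - ‖(inner ℂ (ξ n).1 φ.1 : ℂ)‖| ≤ ε n / 8 ∧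
        ∀ σ m, C.acceptProb (QEnt.labelled (k n) σ m φ.1) = p ^ 2 := by
    intro n
    by_cases hn : 1 ≤ ℓ n
    · obtain ⟨C, h1, h2⟩ :=
        QEnt.exists_circuit h𝒢 hn (k n) (QEnt.precision (ℓ n) (ε n)) (ξ n)
      refine ⟨C, fun _ => ⟨(Nat.cast_le.2 h1).trans (QEnt.size_bound hn (hε n)), fun φ => ?_⟩⟩
      obtain ⟨p, hp0, hp, hacc⟩ := h2 φ
      exact ⟨p, hp0, hp.trans (QEnt.precision_error (hε n).1), hacc⟩
    -- An arbitrary circuit for length 0, which occurs for at most one `n` because `ℓ` is strictly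
    -- increasing.
    · exact ⟨⟨1, [], by simp, Fin.last _⟩, fun h => absurd h hn⟩
  choose D hD using hD
  have hpos : ∀ᶠ n in atTop, 1 ≤ ℓ n :=
    (eventually_ge_atTop 1).mono fun n hn => hn.trans hξ.1.le_apply
  refine ⟨fun n => (D n).size, ?_, D, ?_, fun n => le_rfl⟩
  · refine IsBigO.trans (IsBigO.of_bound 15000 ?_) hgrowth
    filter_upwards [hpos] with n hn
    rw [Real.norm_of_nonneg (by positivity), Real.norm_of_nonneg (by positivity)]
    exact (hD n hn).1
  · filter_upwards [hpos, hfar] with n hn hfar φ σ m hm hach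
    -- The same circuit is run on `ξ n`, whose overlap with itself is 1, and on the separable `φ`.
    obtain ⟨p, -, hp, hpacc⟩ := (hD n hn).2 (ξ n)
    obtain ⟨q, hq0, hq, hqacc⟩ := (hD n hn).2 φ
    have hself : ‖(inner ℂ (ξ n).1 (ξ n).1 : ℂ)‖ = 1 := by
      rw [inner_self_eq_norm_sq_to_K, (ξ n).2]
      norm_num
    rw [hself] at hp
    rw [QEnt.Circuit.Distinguishes, hpacc, hqacc]
    exact QEnt.distinguishing_gap (hε n) (hεδ n) (norm_nonneg _)
      (QEnt.overlap_sq_lt_of_lt_sdis (hδ n).1 hfar ⟨σ, m, hm, hach⟩) le_rfl hq0 hp hq
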